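/- **Random gadget.** Let $m,p,d_{in},d_{out}$ be positive integers with $p\le m$. The random graph $G\sim\mathcal G(m,p,d_{in},d_{out})$ is defined as follows. Its vertex set is $V_G=L\cup R$ with $L\cap R=\emptyset$ and $|L|=|R|=m$. Choose $P\subseteq V_G$ (the *ports*) uniformly among all subsets with $|P\cap L|=|P\cap R|=p$. Choose $d_{in}$ independent uniformly random perfect matchings between $L$ and $R$, and $d_{out}$ independent uniformly random perfect matchings between $L\setminus P$ and $R\setminus P$. The edge set of $G$ is the union of all these matchings, with multiple edges replaced by single edges. Let $\sigma^+(G)$ be the configuration assigning $+$ to every vertex of $L$ and $-$ to every vertex of $R$, and let $\sigma^-(G)$ be the configuration with $+$ and $-$ interchanged. **Ising model.** For a finite simple graph $H=(V,E)$ and $\beta\in\mathbb R$, $\mu_{H,\beta}$ is the probability distribution on $\{+,-\}^V$ with $\mu_{H,\beta}(\sigma)\propto e^{\beta A(\sigma)}$, where $A(\sigma)$ is the number of edges of $H$ whose endpoints have the same spin. **Extensions.** An *extension* of $G$ is a finite simple graph $G'$ containing $G$ as an induced subgraph such that, with $\partial P=V_{G'}\setminus V_G$, every vertex of $P$ has at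 most $d_{out}$ neighbours in $\partial P$, and there are no edges between $V_G\setminus P$ and $\partial P$. **Theorem.** Let $\alpha\in(0,\tfrac14]$ and let $D$ be a constant. There are a constant $\delta>0$ and a function $\varepsilon(m)\to0$ as $m\to\infty$, depending only on $\alpha$ and $D$, such that the following holds for all integers $m\ge1$ and $3\le d\le D$ and all real $\beta<0$. Set $d_{in}=d-1$, $d_{out}=1$, $p=\lfloor m^\alpha\rfloor$ and let $G\sim\mathcal G(m,p,d_{in},d_{out})$. With probability at least $1-\varepsilon(m)$ over the choice of $G$ (including its ports), for every extension $G'$ of $G$ and every configuration $\tau\in\{+,-\}^{\partial P}$, $$\mu_{G',\beta}\bigl(\{\sigma^+(G),\sigma^-(G)\}\mid \partial P=\tau\bigr)\;\ge\;1-\frac{2m}{e^{\delta|\beta|d}},$$ where $\{\sigma^+(G),\sigma^-(G)\}$ denotes the event that the restriction of the configuration to $V_G$ is $\sigma^+(G)$ or $\sigma^-(G)$. -/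

import Mathlib

open Filter Topology

universe u

open scoped Classical in
/-- The number `A(σ)` of monochromatic edges of the configuration `σ : V → Bool`
(`true` is the spin `+`, `false` is the spin `-`). -/
noncomputable def monoEdgeCount {V : Type*} [Fintype V] (G : SimpleGraph V) (σ : V → Bool) : ℕ :=
  (G.edgeFinset.filter (fun e => ∃ b : Bool, ∀ v ∈ e, σ v = b)).card

/-- The Ising weight `exp (β A(σ))`; the model is antiferromagnetic when `β < 0`. -/
noncomputable def isingWeight {V : Type*} [Fintype V] (G : SimpleGraph V) (β : ℝ)
    (σ : V → Bool) : ℝ :=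
  Real.exp (β * monoEdgeCount G σ)

open scoped Classical in
/-- The Gibbs probability `μ_{G,β}(A)` of a set `A` of configurations: total weight of `A`
divided by the partition function. -/
noncomputable def isingProb {V : Type*} [Fintype V] (G : SimpleGraph V) (β : ℝ)
    (A : Set (V → Bool)) : ℝ :=
  (∑ σ : V → Bool with σ ∈ A, isingWeight G β σ) / ∑ σ : V → Bool, isingWeight G β σ

/-- The conditional Gibbs probability `μ_{G,β}(A ∣ B)`. -/
noncomputable def isingCondProb {V : Type*} [Fintype V] (G : SimpleGraph V) (β : ℝ)
    (A B : Set (V → Bool)) : ℝ :=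
  isingProb G β (A ∩ B) / isingProb G β B

/-- The vertex set `V_G = L ∪ R` of the gadget: `L` is the left copy of `Fin m`, `R` the right
copy. -/
abbrev GadgetVertex (m : ℕ) : Type := Fin m ⊕ Fin m

/-- The sets of `p` elements of `Fin m`, i.e. the possible sets of ports of one side. -/
abbrev PortSet (m p : ℕ) : Type := {P : Finset (Fin m) // P.card = p}

/-- An outcome of all the random choices made by the gadget: the ports `P ∩ L` and `P ∩ R`,
the `dIn` perfect matchings between `L` and `R`, and the `dOut` perfect matchings between
`L \ P` and `R \ P`. The number of choices of matchings is the same for all choices of ports, so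
choosing the ports uniformly and then the matchings uniformly and independently is the uniform
distribution on this finite type. -/
abbrev GadgetOutcome (m p dIn dOut : ℕ) : Type :=
  (P : PortSet m p × PortSet m p) ×
    ((Fin dIn → (Fin m ≃ Fin m)) ×
      (Fin dOut → ({x : Fin m // x ∉ P.1.1} ≃ {y : Fin m // y ∉ P.2.1})))

namespace GadgetOutcome

variable {m p dIn dOut : ℕ}

/-- The set `P` of ports. -/
def ports (g : GadgetOutcome m p dIn dOut) : Set (GadgetVertex m) :=
  {v | Sum.elim (fun i => i ∈ g.1.1.1) (fun j => j ∈ g.1.2.1) v}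

/-- Some matching of the outcome joins `i ∈ L` to `j ∈ R`. -/
def Joined (g : GadgetOutcome m p dIn dOut) (i j : Fin m) : Prop :=
  (∃ k, g.2.1 k i = j) ∨ ∃ k, ∃ h : i ∉ g.1.1.1, (g.2.2 k ⟨i, h⟩ : Fin m) = j

/-- The simple bipartite graph `G`: the union of all the matchings, multiple edges being replaced
by single edges. -/
def graph (g : GadgetOutcome m p dIn dOut) : SimpleGraph (GadgetVertex m) :=
  SimpleGraph.fromRel (fun u v => ∃ i j, u = Sum.inl i ∧ v = Sum.inr j ∧ g.Joined i j)

/-- `G'` is a graph on `V_G ∪ ∂P`, where `W` is the set `∂P` of vertices outside the gadget, such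
that `G` is an induced subgraph of `G'`, every port has at most `dOut` neighbours in `∂P`, and
there are no edges between `V_G \ P` and `∂P`. Edges inside `∂P` are arbitrary. -/
structure IsExtension {W : Type*} (g : GadgetOutcome m p dIn dOut)
    (G' : SimpleGraph (GadgetVertex m ⊕ W)) : Prop where
  induced : ∀ u v : GadgetVertex m, G'.Adj (Sum.inl u) (Sum.inl v) ↔ g.graph.Adj u v
  port : ∀ v ∈ g.ports, {w : W | G'.Adj (Sum.inl v) (Sum.inr w)}.encard ≤ dOut
  nonport : ∀ v ∉ g.ports, ∀ w : W, ¬ G'.Adj (Sum.inl v) (Sum.inr w)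

end GadgetOutcome

open scoped Classical in
/-- The probability of the event `E` over the random gadget with distribution
`𝒢(m, p, dIn, dOut)`. -/
noncomputable def gadgetProb (m p dIn dOut : ℕ) (E : Set (GadgetOutcome m p dIn dOut)) : ℝ :=
  ((Finset.univ.filter (fun g => g ∈ E)).card : ℝ) / Fintype.card (GadgetOutcome m p dIn dOut)

/-- The configuration `σ⁺(G)`: `+` on `L` and `-` on `R`. -/
def sigmaPlus (m : ℕ) : GadgetVertex m → Bool := Sum.elim (fun _ => true) (fun _ => false)

/-- The configuration `σ⁻(G)`: `-` on `L` and `+` on `R`. -/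
def sigmaMinus (m : ℕ) : GadgetVertex m → Bool := Sum.elim (fun _ => false) (fun _ => true)

/-- The event `{σ⁺(G), σ⁻(G)}`: the restriction to `V_G` is one of these two configurations. -/
def phaseEvent (m : ℕ) (W : Type*) : Set (GadgetVertex m ⊕ W → Bool) :=
  {σ | σ ∘ Sum.inl = sigmaPlus m ∨ σ ∘ Sum.inl = sigmaMinus m}

/-- The event `{∂P = τ}`. -/
def boundaryEvent (m : ℕ) {W : Type*} (τ : W → Bool) : Set (GadgetVertex m ⊕ W → Bool) :=
  {σ | σ ∘ Sum.inr = τ}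

/-!
# Phases of the antiferromagnetic Ising model on a random bipartite gadget

The two ground states of the gadget have no monochromatic edge. Flipping one of them on a set `S` of
vertices creates a monochromatic edge for every edge of the gadget leaving `S`, and gains at most one
edge for every port in `S`. So if every `S` with at most `m` elements satisfies the expansion
inequality `η |S| + |S ∩ P| ≤ e(S, Sᶜ)` (`GadgetOutcome.Expands`), every flip costs a factor
`exp (-|β| η)` per flipped vertex, and summing over all configurations gives the bound on the
conditional probability, for all extensions and boundary conditions at once
(`GadgetOutcome.Expands.le_isingCondProb`).

It remains to see that the random gadget expands with high probability. Adding matchings can only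
help, so two of the inner matchings and the outer matching suffice. A set violating expansion leaves
a trap (`GadgetOutcome.hasTrap_of_not_expands`), of one of two kinds.

* Sets of size `O(m ^ (1/4))`. After the ends of double edges have been absorbed
  (`exists_superset_multicut_le`), a violating set of size `s` contains nearly `3 s / 2` ports and
  matching edges. Each of these has probability `O(m ^ (-3/4))`, and there are at most `(2 m) ^ s`
  sets, so the expected number of such sets tends to `0` because `(3/4) (3/2) > 1`
  (`gadgetProb_hasSmallTrap_le`).
* Larger sets. Here the ports are negligible, and in a violating set all three matchings pair
  nearly all vertices of `S` with one another. There are about `C(m, s/2) ^ 2` balanced sets, and each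
  of the matchings has probability about `C(m, s/2)⁻¹` of doing so, up to an entropy factor that is
  small if `η` is small (`gadgetProb_hasLargeTrap_le`).

Both estimates rest on `gadgetProb_traps_le`, the probability that given sets of vertices consist of
ports and are mapped into a given set by the matchings.
-/

/-! ### Expansion forces the ground states -/

section Ising

open Finset
open scoped Classical

variable {m p dIn : ℕ}

/-- Edge expansion with a correction for the ports: every set `S` of at most half of the vertices
sends at least `η |S| + |S ∩ P|` edges to its complement. The term `|S ∩ P|` pays for the edges from
`S` to the boundary, of which each port has at most one. -/
def GadgetOutcome.Expands {dOut : ℕ} (g : GadgetOutcome m p dIn dOut) (η : ℝ) : Prop :=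
  ∀ S : Finset (GadgetVertex m), #S ≤ m →
    η * #S + #{v ∈ S | v ∈ g.ports} ≤ #(g.graph.interedges S Sᶜ)

/-- The monochromatic edges as a set of edges, in a form that does not mention the decidability
instances in the definition of `monoEdgeCount`. -/
theorem exists_monoEdgeCount_eq_card {V : Type*} [Fintype V] (G : SimpleGraph V) (σ : V → Bool) :
    ∃ E : Finset (Sym2 V), monoEdgeCount G σ = #E ∧
      ∀ a b, s(a, b) ∈ E ↔ G.Adj a b ∧ σ a = σ b := by
  refine ⟨_, rfl, fun a b => ?_⟩
  simp only [mem_filter, SimpleGraph.mem_edgeFinset, SimpleGraph.mem_edgeSet, Sym2.mem_iff]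
  refine and_congr_right fun _ => ⟨?_, fun h => ⟨σ b, ?_⟩⟩
  · rintro ⟨c, hc⟩
    rw [hc a (Or.inl rfl), hc b (Or.inr rfl)]
  · rintro v (rfl | rfl)
    exacts [h, rfl]

/-- Let `ρ` be a configuration of the gadget without monochromatic edges, and flip it on `S`. All
edges between `S` and its complement become monochromatic, and the only monochromatic edges that can
be lost join a port in `S` to the boundary. -/
theorem monoEdgeCount_add_interedges_le {W : Type*} [Fintype W] {g : GadgetOutcome m p dIn 1}
    {G' : SimpleGraph (GadgetVertex m ⊕ W)} (hG : g.IsExtension G')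
    {ρ : GadgetVertex m → Bool} (hρ : ∀ u v, g.graph.Adj u v → ρ u ≠ ρ v)
    (ς : GadgetVertex m → Bool) (τ : W → Bool) {S : Finset (GadgetVertex m)}
    (hS : ∀ v, v ∈ S ↔ ς v ≠ ρ v) :
    monoEdgeCount G' (Sum.elim ρ τ) + #(g.graph.interedges S Sᶜ) ≤
      monoEdgeCount G' (Sum.elim ς τ) + #{v ∈ S | v ∈ g.ports} := by
  obtain ⟨E₀, hE₀, h₀⟩ := exists_monoEdgeCount_eq_card G' (Sum.elim ρ τ)
  obtain ⟨E₁, hE₁, h₁⟩ := exists_monoEdgeCount_eq_card G' (Sum.elim ς τ)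
  rw [hE₀, hE₁]
  have hcut : #(g.graph.interedges S Sᶜ) ≤ #(E₁ \ E₀) := by
    refine card_le_card_of_injOn (fun e => s(Sum.inl e.1, Sum.inl e.2)) ?_ ?_
    · rintro ⟨a, b⟩ hab
      simp only [SimpleGraph.interedges, Rel.interedges, coe_filter, mem_product, mem_compl,
        Set.mem_ofPred_eq] at hab
      obtain ⟨⟨ha, hb⟩, hadj⟩ := hab
      have := hρ a b hadj
      have ha' := (hS a).1 ha
      have hb' := (hS b).not.1 hb
      simp only [coe_sdiff, Set.mem_sdiff, mem_coe, h₀, h₁, hG.induced, hadj, Sum.elim_inl,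
        true_and]
      revert this ha' hb'
      cases ς a <;> cases ς b <;> cases ρ a <;> cases ρ b <;> simp
    · rintro ⟨a, b⟩ hab ⟨c, d⟩ hcd h
      simp only [SimpleGraph.interedges, Rel.interedges, coe_filter, mem_product, mem_compl,
        Set.mem_ofPred_eq] at hab hcd
      simp only [Sym2.eq_iff, Sum.inl.injEq] at h
      rcases h with ⟨rfl, rfl⟩ | ⟨rfl, rfl⟩
      · rfl
      · exact absurd hab.1.1 hcd.1.2
  have hport : #(E₀ \ E₁) ≤ #{v ∈ S | v ∈ g.ports} := by
    refine card_le_card_of_forall_subsingleton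
      (fun e v => ∃ w, e = s(Sum.inl v, Sum.inr w) ∧ G'.Adj (Sum.inl v) (Sum.inr w)) ?_ ?_
    · have key : ∀ (v : GadgetVertex m) (w : W), G'.Adj (Sum.inl v) (Sum.inr w) → ρ v = τ w →
          ¬ ς v = τ w → v ∈ ({v ∈ S | v ∈ g.ports} : Finset _) := by
        intro v w hadj h1 h2
        rw [mem_filter, hS]
        refine ⟨fun h => h2 (h.trans h1), ?_⟩
        by_contra hv
        exact hG.nonport v hv w hadj
      intro e
      induction e using Sym2.ind with
      | _ a b =>
        rw [Finset.mem_sdiff, h₀, h₁]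
        rintro ⟨⟨hadj, h1⟩, h2⟩
        have h2 := fun h => h2 ⟨hadj, h⟩
        rcases a with a | a <;> rcases b with b | b <;>
          simp only [Sum.elim_inl, Sum.elim_inr] at h1 h2
        · exact absurd h1 (hρ a b ((hG.induced a b).1 hadj))
        · exact ⟨a, key a b hadj h1 h2, b, rfl, hadj⟩
        · exact ⟨b, key b a hadj.symm h1.symm fun h => h2 h.symm, a, Sym2.eq_swap, hadj.symm⟩
        · exact absurd h1 h2
    · rintro v hv e ⟨-, w, rfl, hw⟩ e' ⟨-, w', rfl, hw'⟩
      have := hG.port v (mem_filter.1 hv).2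
      rw [Nat.cast_one, Set.encard_le_one_iff] at this
      rw [this w w' hw hw']
  have e1 := card_sdiff_add_card E₁ E₀
  have e2 := card_sdiff_add_card E₀ E₁
  rw [union_comm] at e2
  omega

theorem one_sub_le_inv_one_add_pow {x : ℝ} (hx : 0 < x) (n : ℕ) :
    1 - n * x ≤ ((1 + x) ^ n)⁻¹ := by
  rcases le_or_gt 1 x with h | h
  · rcases Nat.eq_zero_or_pos n with rfl | hn
    · simp
    · have : (1 : ℝ) ≤ n := by exact_mod_cast hn
      have : 1 - n * x ≤ 0 := by nlinarith
      exact this.trans (by positivity)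
  · have h1 : 1 - n * x ≤ (1 - x) ^ n := by
      have := one_add_mul_le_pow (a := -x) (by linarith) n
      calc _ = 1 + n * -x := by ring
        _ ≤ _ := this
        _ = _ := by ring
    refine h1.trans ?_
    rw [← inv_pow]
    refine pow_le_pow_left₀ (by linarith) ?_ n
    rw [le_inv_comm₀ (by linarith) (by linarith), ← one_div, le_div_iff₀ (by linarith)]
    nlinarith

theorem isingCondProb_eq_div {V : Type*} [Fintype V] (G : SimpleGraph V) (β : ℝ)
    (A B : Set (V → Bool)) :
    isingCondProb G β A B =
      (∑ σ : V → Bool with σ ∈ A ∩ B, isingWeight G β σ) /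
        ∑ σ : V → Bool with σ ∈ B, isingWeight G β σ := by
  have hZ : 0 < ∑ σ : V → Bool, isingWeight G β σ :=
    sum_pos (fun _ _ => Real.exp_pos _) univ_nonempty
  rw [isingCondProb, isingProb, isingProb, div_div_div_cancel_right₀ hZ.ne']
  congr!

/-- Given `τ`, the configurations are those of the gadget, and the phase event consists of two of
them. -/
theorem isingCondProb_boundaryEvent {W : Type*} [Fintype W]
    (G' : SimpleGraph (GadgetVertex m ⊕ W)) (β : ℝ) (τ : W → Bool) (hm : 1 ≤ m) :
    isingCondProb G' β (phaseEvent m W) (boundaryEvent m τ) =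
      (isingWeight G' β (Sum.elim (sigmaPlus m) τ) + isingWeight G' β (Sum.elim (sigmaMinus m) τ)) /
        ∑ ς : GadgetVertex m → Bool, isingWeight G' β (Sum.elim ς τ) := by
  have hne : sigmaPlus m ≠ sigmaMinus m := fun h => by
    simpa [sigmaPlus, sigmaMinus] using congrFun h (Sum.inl ⟨0, hm⟩)
  have hB : ∑ σ : GadgetVertex m ⊕ W → Bool with σ ∈ boundaryEvent m τ, isingWeight G' β σ =
      ∑ ς : GadgetVertex m → Bool, isingWeight G' β (Sum.elim ς τ) := by
    refine sum_nbij' (fun σ => σ ∘ Sum.inl) (fun ς => Sum.elim ς τ) ?_ ?_ ?_ ?_ ?_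
    · simp
    · exact fun ς _ => mem_filter.2 ⟨mem_univ _, rfl⟩
    · intro σ hσ
      have hσ : σ ∘ Sum.inr = τ := (mem_filter.1 hσ).2
      rw [← hσ, Sum.elim_comp_inl_inr]
    · simp
    · intro σ hσ
      have hσ : σ ∘ Sum.inr = τ := (mem_filter.1 hσ).2
      rw [← hσ, Sum.elim_comp_inl_inr]
  have hA : ∑ σ : GadgetVertex m ⊕ W → Bool with σ ∈ phaseEvent m W ∩ boundaryEvent m τ,
      isingWeight G' β σ = isingWeight G' β (Sum.elim (sigmaPlus m) τ) +
        isingWeight G' β (Sum.elim (sigmaMinus m) τ) := by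
    rw [← sum_pair (f := isingWeight G' β) (a := Sum.elim (sigmaPlus m) τ)
      (b := Sum.elim (sigmaMinus m) τ) fun h => hne (by
        simpa using congrArg (fun σ : GadgetVertex m ⊕ W → Bool => σ ∘ Sum.inl) h)]
    refine sum_congr (Finset.ext fun σ => ?_) fun _ _ => rfl
    simp only [mem_filter, mem_univ, true_and, mem_insert, mem_singleton, phaseEvent,
      boundaryEvent, Set.mem_inter_iff, Set.mem_ofPred_eq]
    constructor
    · rintro ⟨h | h, rfl⟩
      · left; rw [← h, Sum.elim_comp_inl_inr]
      · right; rw [← h, Sum.elim_comp_inl_inr]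
    · rintro (rfl | rfl) <;> simp
  rw [isingCondProb_eq_div, ← hA, ← hB]
  congr!

/-- On an expanding gadget the two ground states dominate. With `F ς` the weight of the
configuration `ς` given `τ` and `x = exp (-c)`, expansion bounds `F ς` by `F σ⁺ x ^ |S⁺|` or by
`F σ⁻ x ^ |S⁻|`, where `S^±` is the set on which `ς` differs from `σ^±`: whichever of the two sets has
at most `m` elements. Summing over `ς`, the total weight is at most
`(F σ⁺ + F σ⁻) (1 + x) ^ (2 m)`, and `(1 + x) ^ (-2 m) ≥ 1 - 2 m x`. -/
theorem GadgetOutcome.Expands.le_isingCondProb {g : GadgetOutcome m p dIn 1} {η : ℝ}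
    (hg : g.Expands η) (hm : 1 ≤ m) {W : Type*} [Fintype W]
    {G' : SimpleGraph (GadgetVertex m ⊕ W)} (hG : g.IsExtension G') (τ : W → Bool)
    {β c : ℝ} (hβ : β < 0) (hc : c ≤ |β| * η) :
    1 - 2 * (m : ℝ) / Real.exp c ≤
      isingCondProb G' β (phaseEvent m W) (boundaryEvent m τ) := by
  set x := Real.exp (-c) with hx
  have hx0 : 0 < x := Real.exp_pos _
  set F : (GadgetVertex m → Bool) → ℝ := fun ς => isingWeight G' β (Sum.elim ς τ) with hF
  have hF0 : ∀ ς, 0 < F ς := fun _ => Real.exp_pos _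
  -- the cost of flipping at most half of the vertices of a ground state
  have flip : ∀ ρ : GadgetVertex m → Bool, (∀ u v, g.graph.Adj u v → ρ u ≠ ρ v) →
      ∀ ς : GadgetVertex m → Bool, #{v | ς v ≠ ρ v} ≤ m →
        F ς ≤ F ρ * x ^ #{v | ς v ≠ ρ v} := by
    intro ρ hρ ς hm
    have h1 := monoEdgeCount_add_interedges_le hG hρ ς τ (S := {v | ς v ≠ ρ v}) (by simp)
    have h2 := hg _ hm
    set S : Finset (GadgetVertex m) := {v | ς v ≠ ρ v}
    have h1' : (monoEdgeCount G' (Sum.elim ρ τ) : ℝ) + #(g.graph.interedges S Sᶜ) ≤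
      monoEdgeCount G' (Sum.elim ς τ) + #{v ∈ S | v ∈ g.ports} := by exact_mod_cast h1
    simp only [hF, isingWeight, hx]
    rw [← Real.exp_nat_mul, ← Real.exp_add, Real.exp_le_exp]
    rw [abs_of_neg hβ] at hc
    have h3 : (monoEdgeCount G' (Sum.elim ρ τ) : ℝ) + η * #S ≤ monoEdgeCount G' (Sum.elim ς τ) := by
      linarith
    have h4 := mul_le_mul_of_nonpos_left h3 hβ.le
    have h5 : c * #S ≤ -β * η * #S := mul_le_mul_of_nonneg_right hc (by positivity)
    linarith
  have hadj : ∀ u v, g.graph.Adj u v → sigmaPlus m u ≠ sigmaPlus m v ∧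
      sigmaMinus m u ≠ sigmaMinus m v := by
    rintro u v h
    simp only [GadgetOutcome.graph, SimpleGraph.fromRel_adj] at h
    rcases h with ⟨-, ⟨i, j, rfl, rfl, -⟩ | ⟨i, j, rfl, rfl, -⟩⟩ <;> simp [sigmaPlus, sigmaMinus]
  have hpm : ∀ v, sigmaMinus m v = !sigmaPlus m v := by rintro (v | v) <;> rfl
  have bound : ∀ ς, F ς ≤ F (sigmaPlus m) * x ^ #{v | ς v ≠ sigmaPlus m v} +
      F (sigmaMinus m) * x ^ #{v | ς v ≠ sigmaMinus m v} := by
    intro ς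
    rcases le_or_gt (#{v | ς v ≠ sigmaPlus m v}) m with h | h
    · have := flip _ (fun u v h => (hadj u v h).1) ς h
      have : 0 < F (sigmaMinus m) * x ^ #{v | ς v ≠ sigmaMinus m v} := mul_pos (hF0 _) (by positivity)
      linarith
    · have hc : #{v | ς v ≠ sigmaPlus m v} + #{v | ς v ≠ sigmaMinus m v} = m + m := by
        have : (univ.filter fun v => ς v ≠ sigmaMinus m v) =
            univ.filter fun v => ¬ ς v ≠ sigmaPlus m v := by
          ext v; simp [hpm]
        rw [this, card_filter_add_card_filter_not]
        simp
      have := flip _ (fun u v h => (hadj u v h).2) ς (by omega)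
      have : 0 < F (sigmaPlus m) * x ^ #{v | ς v ≠ sigmaPlus m v} := mul_pos (hF0 _) (by positivity)
      linarith
  -- configurations correspond to the sets on which they differ from `ρ`
  have total : ∀ ρ : GadgetVertex m → Bool,
      ∑ ς : GadgetVertex m → Bool, x ^ #{v | ς v ≠ ρ v} = (1 + x) ^ (2 * m) := by
    intro ρ
    have h := Fintype.sum_pow_mul_eq_add_pow (GadgetVertex m) x 1
    simp only [one_pow, mul_one, Fintype.card_sum, Fintype.card_fin] at h
    rw [add_comm 1 x, two_mul, ← h]
    refine sum_nbij' (fun ς => univ.filter fun v => ς v ≠ ρ v) (fun S v => if v ∈ S then !ρ v else ρ v)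
      ?_ ?_ ?_ ?_ ?_
    · simp
    · simp
    · intro ς _
      funext v
      simp only [mem_filter, mem_univ, true_and]
      cases ς v <;> cases ρ v <;> simp
    · intro S _
      ext v
      by_cases hv : v ∈ S <;> simp [hv]
    · simp
  have hsum : ∑ ς, F ς ≤ (F (sigmaPlus m) + F (sigmaMinus m)) * (1 + x) ^ (2 * m) := by
    refine (sum_le_sum fun ς _ => bound ς).trans ?_
    rw [sum_add_distrib, ← mul_sum, ← mul_sum, total, total, add_mul]
  rw [isingCondProb_boundaryEvent G' β τ hm]
  have h1 : 1 - 2 * (m : ℝ) / Real.exp c ≤ ((1 + x) ^ (2 * m))⁻¹ := by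
    have := one_sub_le_inv_one_add_pow hx0 (2 * m)
    rw [hx, Real.exp_neg] at this ⊢
    push_cast at this
    rwa [div_eq_mul_inv]
  refine h1.trans ?_
  rw [le_div_iff₀ (sum_pos (fun _ _ => hF0 _) univ_nonempty), inv_mul_le_iff₀ (by positivity),
    mul_comm]
  exact hsum

end Ising

/-! ### Multiple edges of a union of three matchings -/

section Multicut

open Finset
open scoped Classical

variable {V : Type*} [Fintype V]

/-- A single relation whose edges belong to the graph has at most as many exits from `S` as there
are edges leaving `S`. -/
theorem card_filter_exists_notMem_le_card_interedges {G : SimpleGraph V} {r : V → V → Prop}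
    (hadj : ∀ x y, r x y → G.Adj x y) (S : Finset V) :
    #{x ∈ S | ∃ y ∉ S, r x y} ≤ #(G.interedges S Sᶜ) := by
  refine card_le_card_of_forall_subsingleton (fun x e => x = e.1) (fun x hx => ?_) ?_
  · obtain ⟨hx, y, hy, h⟩ := mem_filter.1 hx
    refine ⟨(x, y), ?_, rfl⟩
    simpa [SimpleGraph.mem_interedges_iff] using ⟨hx, hy, hadj x y h⟩
  · rintro e - x ⟨-, rfl⟩ x' ⟨-, rfl⟩
    rfl

/-- The number of edges leaving `S` in a graph containing three partial matchings, where multiple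
edges count once, is at least the number leaving some `T ⊇ S` counted with multiplicity. The set `T`
adds to `S` the outer ends of the multiple edges leaving `S`. No multiple edge leaves `T`, and an
added vertex has at most one matching edge leaving `T`, which is charged to the multiple edge that
made it join. -/
theorem exists_superset_multicut_le {G : SimpleGraph V} {R : Fin 3 → V → V → Prop}
    (hsymm : ∀ k x y, R k x y → R k y x) (hfun : ∀ k x y z, R k x y → R k x z → y = z)
    (hadj : ∀ k x y, R k x y → G.Adj x y) (S : Finset V) :
    ∃ T, S ⊆ T ∧ #T ≤ 2 * #S ∧
      ∑ k, #{x ∈ T | ∃ y ∉ T, R k x y} ≤ #(G.interedges S Sᶜ) := by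
  have pigeon : ∀ k l i j : Fin 3, k ≠ l → i ≠ j → k = i ∨ k = j ∨ l = i ∨ l = j := by decide
  set Dbl : V → V → Prop := fun x y => ∃ i j, i ≠ j ∧ R i x y ∧ R j x y with hDbl
  have dbl_unique : ∀ x y z, Dbl x y → Dbl x z → y = z := by
    rintro x y z ⟨i, j, hij, hi, hj⟩ ⟨k, l, hkl, hk, hl⟩
    rcases pigeon k l i j hkl hij with rfl | rfl | rfl | rfl
    exacts [hfun _ _ _ _ hi hk, hfun _ _ _ _ hj hk, hfun _ _ _ _ hi hl, hfun _ _ _ _ hj hl]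
  have dbl_symm : ∀ x y, Dbl x y → Dbl y x := by
    rintro x y ⟨i, j, hij, hi, hj⟩
    exact ⟨i, j, hij, hsymm _ _ _ hi, hsymm _ _ _ hj⟩
  set D : Finset V := {y | y ∉ S ∧ ∃ x ∈ S, Dbl x y} with hD
  have hmemD : ∀ y, y ∈ D ↔ y ∉ S ∧ ∃ x ∈ S, Dbl x y := by simp [hD]
  refine ⟨S ∪ D, subset_union_left, ?_, ?_⟩
  · have : #D ≤ #S := by
      refine card_le_card_of_forall_subsingleton (fun y x => Dbl x y) (fun y hy => ?_) ?_
      · exact ((hmemD y).1 hy).2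
      · rintro x - y ⟨-, hy⟩ z ⟨-, hz⟩
        exact dbl_unique x y z hy hz
    have := card_union_le S D
    omega
  · rw [← card_sigma]
    refine card_le_card_of_forall_subsingleton
      (fun (q : (_ : Fin 3) × V) e =>
        (q.2 = e.1 ∧ q.2 ∈ S ∧ R q.1 q.2 e.2 ∧ e.2 ∉ S ∪ D) ∨
        (q.2 = e.2 ∧ q.2 ∈ D ∧ Dbl q.2 e.1 ∧ e.1 ∈ S ∧ ∃ z, z ∉ S ∪ D ∧ R q.1 q.2 z)) ?_ ?_
    · rintro ⟨k, x⟩ hx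
      simp only [mem_sigma, mem_univ, true_and, mem_filter] at hx
      obtain ⟨hx, y, hy, hR⟩ := hx
      rcases mem_union.1 hx with hxS | hxD
      · refine ⟨(x, y), ?_, Or.inl ⟨rfl, hxS, hR, hy⟩⟩
        simp only [SimpleGraph.mem_interedges_iff, mem_compl]
        exact ⟨hxS, fun h => hy (mem_union_left _ h), hadj _ _ _ hR⟩
      · obtain ⟨hxS, x', hx', hd⟩ := (hmemD x).1 hxD
        refine ⟨(x', x), ?_, Or.inr ⟨rfl, hxD, dbl_symm _ _ hd, hx', y, hy, hR⟩⟩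
        simp only [SimpleGraph.mem_interedges_iff, mem_compl]
        obtain ⟨i, -, -, hi, -⟩ := hd
        exact ⟨hx', hxS, hadj _ _ _ hi⟩
    · rintro ⟨u, v⟩ - ⟨k, x⟩ ⟨-, h⟩ ⟨l, x'⟩ ⟨-, h'⟩
      simp only at h h'
      rcases h with ⟨rfl, hxS, hR, hv⟩ | ⟨rfl, hxD, hd, hu, z, hz, hR⟩ <;>
      rcases h' with ⟨rfl, hxS', hR', hv'⟩ | ⟨rfl, hxD', hd', hu', z', hz', hR'⟩
      · -- a double edge leaving `S` would have its end in `D`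
        by_cases hkl : k = l
        · rw [hkl]
        · refine absurd (mem_union_right _ ((hmemD v).2 ⟨?_, x', hxS, k, l, hkl, hR, hR'⟩)) hv
          exact fun h => hv (mem_union_left _ h)
      · exact absurd (mem_union_right _ hxD') hv
      · exact absurd (mem_union_right _ hxD) hv'
      · -- an end of a double edge has only one further matching
        by_cases hkl : k = l
        · rw [hkl]
        · obtain ⟨i, j, hij, hi, hj⟩ := hd
          have hu := mem_union_left D hu
          rcases pigeon k l i j hkl hij with rfl | rfl | rfl | rfl
          · exact absurd (hfun _ _ _ _ hi hR ▸ hu) hz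
          · exact absurd (hfun _ _ _ _ hj hR ▸ hu) hz
          · exact absurd (hfun _ _ _ _ hi hR' ▸ hu) hz'
          · exact absurd (hfun _ _ _ _ hj hR' ▸ hu) hz'

end Multicut

/-! ### Partial matchings between the two sides -/

section Bipartite

open Finset
open scoped Classical

variable {m : ℕ}

/-- The symmetric relation on `L ∪ R` given by a relation between `L` and `R`. -/
def bipartiteRel (r : Fin m → Fin m → Prop) : GadgetVertex m → GadgetVertex m → Prop
  | Sum.inl i, Sum.inr j => r i j
  | Sum.inr j, Sum.inl i => r i j
  | _, _ => False

theorem bipartiteRel_symm {r : Fin m → Fin m → Prop} {x y : GadgetVertex m}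
    (h : bipartiteRel r x y) : bipartiteRel r y x := by
  rcases x with x | x <;> rcases y with y | y <;> exact h

theorem bipartiteRel_unique {r : Fin m → Fin m → Prop} (hr : Relator.BiUnique r)
    {x y z : GadgetVertex m} (h : bipartiteRel r x y) (h' : bipartiteRel r x z) : y = z := by
  rcases x with x | x <;> rcases y with y | y <;> rcases z with z | z <;>
    simp only [bipartiteRel] at h h'
  · rw [hr.2 h h']
  · rw [hr.1 h h']

theorem card_filter_exists_comm {r : Fin m → Fin m → Prop} (hr : Relator.BiUnique r)
    (A B : Finset (Fin m)) : #{i ∈ A | ∃ j ∈ B, r i j} = #{j ∈ B | ∃ i ∈ A, r i j} := by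
  apply le_antisymm
  · refine card_le_card_of_forall_subsingleton (fun i j => r i j) (fun i hi => ?_) ?_
    · obtain ⟨hi, j, hj, h⟩ := mem_filter.1 hi
      exact ⟨j, mem_filter.2 ⟨hj, i, hi, h⟩, h⟩
    · rintro j - i ⟨-, h⟩ i' ⟨-, h'⟩
      exact hr.1 h h'
  · refine card_le_card_of_forall_subsingleton (fun j i => r i j) (fun j hj => ?_) ?_
    · obtain ⟨hj, i, hi, h⟩ := mem_filter.1 hj
      exact ⟨i, mem_filter.2 ⟨hi, j, hj, h⟩, h⟩
    · rintro i - j ⟨-, h⟩ j' ⟨-, h'⟩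
      exact hr.2 h h'

theorem card_filter_exists_split (A B : Finset (Fin m)) {r : Fin m → Fin m → Prop} (hr : Relator.RightUnique r) :
    #{i ∈ A | ∃ j, r i j} = #{i ∈ A | ∃ j ∈ B, r i j} + #{i ∈ A | ∃ j ∉ B, r i j} := by
  rw [← card_union_of_disjoint]
  · congr 1
    ext i
    simp only [mem_filter, mem_union]
    constructor
    · rintro ⟨hi, j, h⟩
      by_cases hj : j ∈ B
      exacts [Or.inl ⟨hi, j, hj, h⟩, Or.inr ⟨hi, j, hj, h⟩]
    · rintro (⟨hi, j, -, h⟩ | ⟨hi, j, -, h⟩) <;> exact ⟨hi, j, h⟩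
  · rw [Finset.disjoint_left]
    rintro i hi hi'
    obtain ⟨-, j, hj, h⟩ := mem_filter.1 hi
    obtain ⟨-, j', hj', h'⟩ := mem_filter.1 hi'
    exact hj' (hr h h' ▸ hj)

/-- The edges of a partial matching leaving `S`, counted by its endpoints in `S`: an edge inside
`S` has two of them. -/
theorem card_bipartiteRel_exits_add {r : Fin m → Fin m → Prop} (hr : Relator.BiUnique r)
    (S : Finset (GadgetVertex m)) :
    #{x ∈ S | ∃ y ∉ S, bipartiteRel r x y} + 2 * #{i ∈ S.toLeft | ∃ j ∈ S.toRight, r i j} =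
      #{i ∈ S.toLeft | ∃ j, r i j} + #{j ∈ S.toRight | ∃ i, r i j} := by
  have hL : ({x ∈ S | ∃ y ∉ S, bipartiteRel r x y} : Finset _).toLeft =
      {i ∈ S.toLeft | ∃ j ∉ S.toRight, r i j} := by
    ext i
    simp [bipartiteRel]
  have hR : ({x ∈ S | ∃ y ∉ S, bipartiteRel r x y} : Finset _).toRight =
      {j ∈ S.toRight | ∃ i ∉ S.toLeft, r i j} := by
    ext i
    simp [bipartiteRel]
  have h1 := card_filter_exists_split S.toLeft S.toRight hr.2
  have h2 := card_filter_exists_split S.toRight S.toLeft (r := fun j i => r i j)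
    fun _ _ _ h h' => hr.1 h h'
  have h3 := card_filter_exists_comm hr S.toLeft S.toRight
  have h4 := card_toLeft_add_card_toRight (u := ({x ∈ S | ∃ y ∉ S, bipartiteRel r x y} : Finset _))
  rw [hL, hR] at h4
  omega

end Bipartite

/-! ### Failure of expansion leaves a trap -/

section Dichotomy

open Finset
open scoped Classical

variable {m p dIn : ℕ}

namespace GadgetOutcome

/-- The edges of the inner matching with index `c`. -/
def InEdge (g : GadgetOutcome m p dIn 1) (c : Fin dIn) (i j : Fin m) : Prop :=
  g.2.1 c i = j

/-- The edges of the matching which avoids the ports. -/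
def OutEdge (g : GadgetOutcome m p dIn 1) (i j : Fin m) : Prop :=
  ∃ h : i ∉ g.1.1.1, (g.2.2 0 ⟨i, h⟩ : Fin m) = j

/-- The event that the sets `Q₁` and `Q₂` consist of ports, and that the inner matchings `a`, `b`
and the outer matching send `X₀`, `X₁` and `X₂`, respectively, into `B`. -/
structure Traps (g : GadgetOutcome m p dIn 1) (a b : Fin dIn)
    (Q₁ Q₂ X₀ X₁ X₂ B : Finset (Fin m)) : Prop where
  portLeft : Q₁ ⊆ g.1.1.1
  portRight : Q₂ ⊆ g.1.2.1
  fst : ∀ x ∈ X₀, g.2.1 a x ∈ B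
  snd : ∀ x ∈ X₁, g.2.1 b x ∈ B
  out : ∀ x ∈ X₂, ∃ y ∈ B, g.OutEdge x y

/-- A nonempty set `S` of at most `t` vertices contains at least `17 |S| / 12` ports and matching
edges in total. The edges inside `S` are given by their ends in `L`. -/
def HasSmallTrap (g : GadgetOutcome m p dIn 1) (a b : Fin dIn) (t : ℕ) : Prop :=
  ∃ S : Finset (GadgetVertex m), S.Nonempty ∧ #S ≤ t ∧ ∃ Q₁ ⊆ S.toLeft, ∃ Q₂ ⊆ S.toRight,
    ∃ X₀ ⊆ S.toLeft, ∃ X₁ ⊆ S.toLeft, ∃ X₂ ⊆ S.toLeft,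
      17 * #S ≤ 12 * (#Q₁ + #Q₂ + #X₀ + #X₁ + #X₂) ∧ g.Traps a b Q₁ Q₂ X₀ X₁ X₂ S.toRight

/-- For some `k ≥ n`, the matching `a` sends a `k`-element set onto a `k`-element set and the two
other matchings nearly do so. -/
def HasLargeTrap (g : GadgetOutcome m p dIn 1) (a b : Fin dIn) (n : ℕ) : Prop :=
  ∃ k, n ≤ k ∧ 2 * k ≤ m ∧ ∃ X Y : Finset (Fin m), #X = k ∧ #Y = k ∧
    ∃ X₁ ⊆ X, ∃ X₂ ⊆ X, #X₁ = k - k / 200 ∧ #X₂ = k - k / 200 ∧ g.Traps a b ∅ ∅ X X₁ X₂ Y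

theorem biUnique_inEdge (g : GadgetOutcome m p dIn 1) (c : Fin dIn) :
    Relator.BiUnique (g.InEdge c) :=
  ⟨fun _ _ _ h h' => (g.2.1 c).injective (h.trans h'.symm), fun _ _ _ h h' => h.symm.trans h'⟩

theorem biUnique_outEdge (g : GadgetOutcome m p dIn 1) : Relator.BiUnique g.OutEdge := by
  refine ⟨?_, ?_⟩
  · rintro i i' j ⟨h, rfl⟩ ⟨h', e⟩
    exact (congrArg Subtype.val ((g.2.2 0).injective (Subtype.ext e))).symm
  · rintro i j j' ⟨h, rfl⟩ ⟨h', rfl⟩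
    rfl

theorem exists_outEdge_left (g : GadgetOutcome m p dIn 1) (i : Fin m) :
    (∃ j, g.OutEdge i j) ↔ i ∉ g.1.1.1 :=
  ⟨fun ⟨_, h, _⟩ => h, fun h => ⟨_, h, rfl⟩⟩

theorem exists_outEdge_right (g : GadgetOutcome m p dIn 1) (j : Fin m) :
    (∃ i, g.OutEdge i j) ↔ j ∉ g.1.2.1 := by
  constructor
  · rintro ⟨i, h, rfl⟩
    exact (g.2.2 0 ⟨i, h⟩).2
  · intro h
    refine ⟨(g.2.2 0).symm ⟨j, h⟩, ((g.2.2 0).symm ⟨j, h⟩).2, ?_⟩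
    simp

theorem graph_adj_of_bipartiteRel (g : GadgetOutcome m p dIn 1) {r : Fin m → Fin m → Prop}
    (hr : ∀ i j, r i j → g.Joined i j) (x y : GadgetVertex m) (h : bipartiteRel r x y) :
    g.graph.Adj x y := by
  rcases x with x | x <;> rcases y with y | y <;> simp only [bipartiteRel] at h
  · exact ⟨by simp, Or.inl ⟨x, y, rfl, rfl, hr _ _ h⟩⟩
  · exact ⟨by simp, Or.inr ⟨y, x, rfl, rfl, hr _ _ h⟩⟩

theorem card_filter_mem_ports (g : GadgetOutcome m p dIn 1) (S : Finset (GadgetVertex m)) :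
    #{v ∈ S | v ∈ g.ports} = #{i ∈ S.toLeft | i ∈ g.1.1.1} + #{j ∈ S.toRight | j ∈ g.1.2.1} := by
  rw [← card_toLeft_add_card_toRight]
  congr 2
  · ext i
    rw [mem_toLeft, mem_filter, mem_filter, mem_toLeft]
    rfl
  · ext i
    rw [mem_toRight, mem_filter, mem_filter, mem_toRight]
    rfl

/-- If the gadget does not expand, then it has a small or a large trap, according to the size of a
set `S` violating expansion. If `|S| ≤ 2406 n`, pass to the set `T` of `exists_superset_multicut_le`,
with `|T| ≤ 2 |S|`: counted with multiplicity it has `3 |T| - q - 2 e` edges leaving it, where `q` is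
the number of ports in `T` and `e` the number of matching edges inside `T`, so that `q + e` is nearly
`3 |T| / 2`. If `|S| > 2406 n`, the ports in `S` are negligible, so each of the three matchings
pairs up nearly all vertices of `S` with one another. -/
theorem hasTrap_of_not_expands (g : GadgetOutcome m p dIn 1) (a b : Fin dIn) {n : ℕ} (hp : p ≤ n)
    (hg : ¬ g.Expands (1 / 1203)) : g.HasSmallTrap a b (4812 * n) ∨ g.HasLargeTrap a b n := by
  unfold Expands at hg
  push Not at hg
  obtain ⟨S, hSm, hS⟩ := hg
  have hS' : 1203 * #(g.graph.interedges S Sᶜ) < #S + 1203 * #{v ∈ S | v ∈ g.ports} := by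
    have : (1203 : ℝ) * #(g.graph.interedges S Sᶜ) < #S + 1203 * #{v ∈ S | v ∈ g.ports} := by
      linarith
    exact_mod_cast this
  have hin : ∀ (c : Fin dIn) (T : Finset (GadgetVertex m)),
      #{x ∈ T | ∃ y ∉ T, bipartiteRel (g.InEdge c) x y} +
        2 * #{i ∈ T.toLeft | ∃ j ∈ T.toRight, g.InEdge c i j} = #T := by
    intro c T
    rw [card_bipartiteRel_exits_add (g.biUnique_inEdge _), ← card_toLeft_add_card_toRight]
    congr 2
    · exact filter_true_of_mem fun i _ => ⟨g.2.1 c i, rfl⟩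
    · exact filter_true_of_mem fun j _ => ⟨(g.2.1 c).symm j, (g.2.1 c).apply_symm_apply j⟩
  have hout : ∀ T : Finset (GadgetVertex m),
      #{x ∈ T | ∃ y ∉ T, bipartiteRel g.OutEdge x y} +
        2 * #{i ∈ T.toLeft | ∃ j ∈ T.toRight, g.OutEdge i j} + #{v ∈ T | v ∈ g.ports} = #T := by
    intro T
    rw [card_bipartiteRel_exits_add g.biUnique_outEdge, card_filter_mem_ports,
      ← card_toLeft_add_card_toRight (u := T)]
    simp only [exists_outEdge_left, exists_outEdge_right]
    have h1 := card_filter_add_card_filter_not (s := T.toLeft) (fun i => i ∈ g.1.1.1)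
    have h2 := card_filter_add_card_filter_not (s := T.toRight) (fun i => i ∈ g.1.2.1)
    omega
  have hadjIn : ∀ (c : Fin dIn) x y, bipartiteRel (g.InEdge c) x y →
      g.graph.Adj x y := fun c =>
    g.graph_adj_of_bipartiteRel fun i j h => Or.inl ⟨c, h⟩
  have hadjOut : ∀ x y, bipartiteRel g.OutEdge x y → g.graph.Adj x y :=
    g.graph_adj_of_bipartiteRel fun i j h => Or.inr ⟨0, h⟩
  rcases le_or_gt (#S) (2406 * n) with hs | hs
  · left
    obtain ⟨R, hR₀, hR₁, hR₂⟩ : ∃ R : Fin 3 → GadgetVertex m → GadgetVertex m → Prop,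
        R 0 = bipartiteRel (g.InEdge a) ∧ R 1 = bipartiteRel (g.InEdge b) ∧
        R 2 = bipartiteRel g.OutEdge :=
      ⟨![bipartiteRel (g.InEdge a), bipartiteRel (g.InEdge b), bipartiteRel g.OutEdge],
        rfl, rfl, rfl⟩
    have hR : ∀ P : (GadgetVertex m → GadgetVertex m → Prop) → Prop, P (bipartiteRel (g.InEdge a)) →
        P (bipartiteRel (g.InEdge b)) → P (bipartiteRel g.OutEdge) → ∀ k, P (R k) := by
      intro P h₀ h₁ h₂ k
      fin_cases k
      exacts [hR₀ ▸ h₀, hR₁ ▸ h₁, hR₂ ▸ h₂]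
    obtain ⟨T, hST, hT, hcut⟩ := exists_superset_multicut_le
      (hR (fun r => ∀ x y, r x y → r y x) (fun x y => bipartiteRel_symm)
        (fun x y => bipartiteRel_symm) (fun x y => bipartiteRel_symm))
      (hR (fun r => ∀ x y z, r x y → r x z → y = z)
        (fun x y z => bipartiteRel_unique (g.biUnique_inEdge _))
        (fun x y z => bipartiteRel_unique (g.biUnique_inEdge _))
        (fun x y z => bipartiteRel_unique g.biUnique_outEdge))
      (hR (fun r => ∀ x y, r x y → g.graph.Adj x y) (hadjIn a) (hadjIn b) hadjOut) S
    have hcut : #{x ∈ T | ∃ y ∉ T, bipartiteRel (g.InEdge a) x y} +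
        #{x ∈ T | ∃ y ∉ T, bipartiteRel (g.InEdge b) x y} +
        #{x ∈ T | ∃ y ∉ T, bipartiteRel g.OutEdge x y} ≤ #(g.graph.interedges S Sᶜ) := by
      rw [Fin.sum_univ_three] at hcut
      simp only [hR₀, hR₁, hR₂] at hcut
      convert hcut
    have h1 := hin a T
    have h2 := hin b T
    have h3 := hout T
    have h4 := card_filter_mem_ports g T
    have h5 : #{v ∈ S | v ∈ g.ports} ≤ #{v ∈ T | v ∈ g.ports} :=
      card_le_card (filter_subset_filter _ hST)
    have h6 : #S ≤ #T := card_le_card hST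
    refine ⟨T, ?_, by omega, {i ∈ T.toLeft | i ∈ g.1.1.1}, filter_subset _ _,
      {j ∈ T.toRight | j ∈ g.1.2.1}, filter_subset _ _,
      {i ∈ T.toLeft | ∃ j ∈ T.toRight, g.InEdge a i j}, filter_subset _ _,
      {i ∈ T.toLeft | ∃ j ∈ T.toRight, g.InEdge b i j}, filter_subset _ _,
      {i ∈ T.toLeft | ∃ j ∈ T.toRight, g.OutEdge i j}, filter_subset _ _, by omega, ?_⟩
    · have h7 : #{v ∈ S | v ∈ g.ports} ≤ #S := card_filter_le _ _
      rw [← card_pos]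
      omega
    · refine ⟨fun i hi => (mem_filter.1 hi).2, fun i hi => (mem_filter.1 hi).2, ?_, ?_,
        fun i hi => (mem_filter.1 hi).2⟩
      all_goals
        intro i hi
        obtain ⟨-, j, hj, rfl⟩ := mem_filter.1 hi
        exact hj
  · right
    have h1 := hin a S
    have h2 := hin b S
    have h3 := hout S
    have exits : ∀ r : Fin m → Fin m → Prop, (∀ x y, bipartiteRel r x y → g.graph.Adj x y) →
        #{x ∈ S | ∃ y ∉ S, bipartiteRel r x y} ≤ #(g.graph.interedges S Sᶜ) := by
      intro r hr
      convert card_filter_exists_notMem_le_card_interedges hr S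
    have c1 := exits _ (hadjIn a)
    have c2 := exits _ (hadjIn b)
    have c3 := exits _ hadjOut
    have hq : #{v ∈ S | v ∈ g.ports} ≤ 2 * p := by
      rw [card_filter_mem_ports, two_mul]
      refine add_le_add ?_ ?_
      · exact (card_le_card fun i hi => (mem_filter.1 hi).2).trans g.1.1.2.le
      · exact (card_le_card fun i hi => (mem_filter.1 hi).2).trans g.1.2.2.le
    have hAB := card_toLeft_add_card_toRight (u := S)
    set A := S.toLeft
    set B := S.toRight
    have hB : #{i ∈ A | ∃ j ∈ B, g.InEdge a i j} ≤ #B := by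
      rw [card_filter_exists_comm (g.biUnique_inEdge _)]
      exact card_filter_le _ _
    have hA : #{i ∈ A | ∃ j ∈ B, g.InEdge a i j} ≤ #A := card_filter_le _ _
    -- `k` is `200 |S| / 401` rounded up: each matching has more than that many edges inside `S`,
    -- and `200 (|S| - 2 k) ≤ k`
    set k := (200 * #S + 400) / 401
    obtain ⟨X, hXA, hXk⟩ := exists_subset_card_eq
      (show k ≤ #{i ∈ A | ∃ j ∈ B, g.InEdge a i j} by omega)
    have hX : ∀ x ∈ X, x ∈ A ∧ g.2.1 a x ∈ B := by
      intro x hx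
      obtain ⟨h, j, hj, rfl⟩ := mem_filter.1 (hXA hx)
      exact ⟨h, hj⟩
    set Y := X.image (g.2.1 a)
    have hYk : #Y = k := by rw [card_image_of_injective _ (g.2.1 a).injective, hXk]
    have hYB : Y ⊆ B := image_subset_iff.2 fun x hx => (hX x hx).2
    have hXA' : X ⊆ A := fun x hx => (hX x hx).1
    -- passing from `A`, `B` to `X`, `Y` loses at most `|A \ X| + |B \ Y|` edges
    have shrink : ∀ {r : Fin m → Fin m → Prop}, Relator.BiUnique r →
        #{i ∈ A | ∃ j ∈ B, r i j} ≤ #{i ∈ X | ∃ j ∈ Y, r i j} + #(A \ X) + #(B \ Y) := by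
      intro r hr
      have : {i ∈ A | ∃ j ∈ B, r i j} ⊆
          ({i ∈ X | ∃ j ∈ Y, r i j} ∪ (A \ X)) ∪ {i ∈ A | ∃ j ∈ B \ Y, r i j} := by
        intro i hi
        obtain ⟨hi, j, hj, h⟩ := mem_filter.1 hi
        by_cases hiX : i ∈ X
        · by_cases hjY : j ∈ Y
          · exact mem_union_left _ (mem_union_left _ (mem_filter.2 ⟨hiX, j, hjY, h⟩))
          · exact mem_union_right _ (mem_filter.2 ⟨hi, j, Finset.mem_sdiff.2 ⟨hj, hjY⟩, h⟩)
        · exact mem_union_left _ (mem_union_right _ (Finset.mem_sdiff.2 ⟨hi, hiX⟩))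
      refine (card_le_card this).trans ((card_union_le _ _).trans (add_le_add
        (card_union_le _ _) ?_))
      rw [card_filter_exists_comm hr]
      exact card_filter_le _ _
    have hAX : #(A \ X) = #A - k := by rw [card_sdiff_of_subset hXA', hXk]
    have hBY : #(B \ Y) = #B - k := by rw [card_sdiff_of_subset hYB, hYk]
    have s1 := shrink (g.biUnique_inEdge b)
    have s2 := shrink g.biUnique_outEdge
    obtain ⟨X₁, hX₁, hX₁k⟩ := exists_subset_card_eq
      (show k - k / 200 ≤ #{i ∈ X | ∃ j ∈ Y, g.InEdge b i j} by omega)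
    obtain ⟨X₂, hX₂, hX₂k⟩ := exists_subset_card_eq
      (show k - k / 200 ≤ #{i ∈ X | ∃ j ∈ Y, g.OutEdge i j} by omega)
    refine ⟨k, by omega, by omega, X, Y, hXk, hYk, X₁, hX₁.trans (filter_subset _ _), X₂,
      hX₂.trans (filter_subset _ _), hX₁k, hX₂k, ?_⟩
    refine ⟨by simp, by simp, fun x hx => mem_image_of_mem _ hx, ?_,
      fun x hx => (mem_filter.1 (hX₂ hx)).2⟩
    intro x hx
    obtain ⟨-, j, hj, rfl⟩ := mem_filter.1 (hX₁ hx)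
    exact hj

end GadgetOutcome

end Dichotomy

/-! ### Counting bijections and sets of ports -/

section Counting

open Finset
open scoped Classical

/-- The ratio `b(b-1)⋯(b-k+1) / n(n-1)⋯(n-k+1)`: the probability that a uniformly random bijection
between two `n`-element sets sends `k` given points into a given set of size `b`. -/
noncomputable def descRatio (b n k : ℕ) : ℝ := (b.descFactorial k : ℝ) / n.descFactorial k

theorem descRatio_nonneg (b n k : ℕ) : 0 ≤ descRatio b n k := by
  unfold descRatio; positivity

theorem descRatio_mono {b b' : ℕ} (h : b ≤ b') (n k : ℕ) : descRatio b n k ≤ descRatio b' n k := by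
  unfold descRatio
  gcongr

theorem descRatio_le_pow {b n : ℕ} (h : b ≤ n) (k : ℕ) : descRatio b n k ≤ ((b : ℝ) / n) ^ k := by
  induction k with
  | zero => simp [descRatio]
  | succ k ih =>
    have step : descRatio b n (k + 1) = (((b - k : ℕ) : ℝ) / ((n - k : ℕ) : ℝ)) * descRatio b n k := by
      unfold descRatio
      rw [Nat.descFactorial_succ, Nat.descFactorial_succ]
      push_cast
      rw [mul_div_mul_comm]
    rw [step, pow_succ']
    refine mul_le_mul ?_ ih (descRatio_nonneg _ _ _) (by positivity)
    rcases le_or_gt b k with hb | hb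
    · rw [Nat.sub_eq_zero_of_le hb]
      simp only [Nat.cast_zero, zero_div]
      positivity
    · rw [Nat.cast_sub hb.le, Nat.cast_sub (hb.le.trans h)]
      have h1 : (k : ℝ) < b := by exact_mod_cast hb
      have h2 : (b : ℝ) ≤ n := by exact_mod_cast h
      have h3 : (0 : ℝ) ≤ k := by positivity
      rw [div_le_div_iff₀ (by linarith) (by linarith)]
      nlinarith

/-- Double counting of the pairs of a bijection `e` sending `insert x X` into `B` and a point
`z ∉ X`: composing `e` with the transposition of `x` and `z` gives a bijection sending `X` into `B`,
and `e x` is a point of `B` outside the image of `X`. -/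
theorem card_equiv_mapsTo_insert_mul_le {α β : Type*} [Fintype α] [Fintype β] {X : Finset α} {x : α}
    (hx : x ∉ X) (B : Finset β) :
    #{e : α ≃ β | ∀ z ∈ insert x X, e z ∈ B} * (Fintype.card α - #X) ≤
      #{e : α ≃ β | ∀ z ∈ X, e z ∈ B} * (#B - #X) := by
  have hB : ∀ e ∈ ({e : α ≃ β | ∀ z ∈ X, e z ∈ B} : Finset (α ≃ β)),
      #(B \ X.image e) = #B - #X := by
    intro e he
    have he := (mem_filter.1 he).2
    rw [card_sdiff_of_subset (image_subset_iff.2 he), card_image_of_injective _ e.injective]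
  have h1 : #(Xᶜ) = Fintype.card α - #X := card_compl X
  rw [← h1, ← card_product, ← smul_eq_mul (b := #B - #X), ← sum_const, ← sum_congr rfl hB,
    ← card_sigma]
  refine card_le_card_of_injOn (fun q => ⟨(Equiv.swap x q.2).trans q.1, q.1 x⟩) ?_ ?_
  · rintro ⟨e, z⟩ hq
    simp only [coe_product, Set.mem_prod, mem_coe, mem_filter, mem_univ, true_and, mem_compl,
      mem_insert, forall_eq_or_imp] at hq
    obtain ⟨⟨hex, he⟩, hz⟩ := hq
    have hfix : ∀ w ∈ X, Equiv.swap x z w = w := fun w hw =>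
      Equiv.swap_apply_of_ne_of_ne (fun h => hx (h ▸ hw)) (fun h => hz (h ▸ hw))
    simp only [coe_sigma, Set.mem_sigma_iff, mem_coe, mem_filter, mem_univ, true_and,
      Finset.mem_sdiff, mem_image, Equiv.trans_apply]
    refine ⟨fun w hw => by rw [hfix w hw]; exact he w hw, hex, ?_⟩
    rintro ⟨w, hw, h⟩
    rw [hfix w hw] at h
    exact hx (e.injective h ▸ hw)
  · rintro ⟨e, z⟩ - ⟨e', z'⟩ - h
    simp only [Sigma.mk.injEq, heq_eq_eq] at h
    obtain ⟨h, hx'⟩ := h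
    have hzz : z = z' := by
      have h2 : ((Equiv.swap x z).trans e) z = ((Equiv.swap x z').trans e') z := by rw [h]
      have h3 : ((Equiv.swap x z').trans e') z' = e' x := by simp
      have h4 : ((Equiv.swap x z).trans e) z = e x := by simp
      have h5 : ((Equiv.swap x z').trans e') z = ((Equiv.swap x z').trans e') z' := by
        rw [← h2, h3, h4, hx']
      exact ((Equiv.swap x z').trans e').injective h5
    subst hzz
    have : e = e' := by
      ext w
      have := congrArg (fun s : α ≃ β => s (Equiv.swap x z w)) h
      simpa using this
    rw [this]

theorem card_equiv_mapsTo_mul_le {α β : Type*} [Fintype α] [Fintype β]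
    (hαβ : Fintype.card α = Fintype.card β) (X : Finset α) (B : Finset β) :
    #{e : α ≃ β | ∀ z ∈ X, e z ∈ B} * (Fintype.card α).descFactorial #X ≤
      (#B).descFactorial #X * (Fintype.card α).factorial := by
  induction X using Finset.induction_on with
  | empty =>
    simp [Fintype.card_equiv (Fintype.equivOfCardEq hαβ)]
  | insert x X hx ih =>
    rw [card_insert_of_notMem hx, Nat.descFactorial_succ, Nat.descFactorial_succ, ← mul_assoc]
    calc _ ≤ #{e : α ≃ β | ∀ z ∈ X, e z ∈ B} * (#B - #X) * (Fintype.card α).descFactorial #X :=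
        Nat.mul_le_mul_right _ (card_equiv_mapsTo_insert_mul_le hx B)
      _ = (#B - #X) * (#{e : α ≃ β | ∀ z ∈ X, e z ∈ B} * (Fintype.card α).descFactorial #X) := by
        ring
      _ ≤ (#B - #X) * ((#B).descFactorial #X * (Fintype.card α).factorial) :=
        Nat.mul_le_mul_left _ ih
      _ = _ := by ring

theorem card_equiv_mapsTo_le {α β : Type*} [Fintype α] [Fintype β] {n : ℕ}
    (hα : Fintype.card α = n) (hβ : Fintype.card β = n) (X : Finset α) (B : Finset β) :
    ({e : α ≃ β | ∀ z ∈ X, e z ∈ B}.ncard : ℝ) ≤ n.factorial * descRatio #B n #X := by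
  have hc : {e : α ≃ β | ∀ z ∈ X, e z ∈ B}.ncard = #{e : α ≃ β | ∀ z ∈ X, e z ∈ B} := by
    rw [← Set.ncard_coe_finset, coe_filter_univ]
  rw [hc]
  have h := card_equiv_mapsTo_mul_le (hα.trans hβ.symm) X B
  have hX : #X ≤ n := hα ▸ card_le_univ X
  have hpos : (0 : ℝ) < n.descFactorial #X := by
    exact_mod_cast Nat.pos_of_ne_zero fun h => absurd (Nat.descFactorial_eq_zero_iff_lt.1 h) (by omega)
  rw [hα] at h
  rw [descRatio, mul_div_assoc', le_div_iff₀ hpos]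
  rw [mul_comm (n.factorial : ℝ)]
  exact_mod_cast h

theorem card_portSet (m p : ℕ) : Fintype.card (PortSet m p) = m.choose p := by
  rw [Fintype.card_finset_len, Fintype.card_fin]

theorem card_portSet_superset_le {m p : ℕ} (hp : p ≤ m) (Q : Finset (Fin m)) :
    ({P : PortSet m p | Q ⊆ P.1}.ncard : ℝ) ≤ m.choose p * ((p : ℝ) / m) ^ #Q := by
  have hc : {P : PortSet m p | Q ⊆ P.1}.ncard = #{P : PortSet m p | Q ⊆ P.1} := by
    rw [← Set.ncard_coe_finset, coe_filter_univ]
  rw [hc]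
  have h1 : #{P : PortSet m p | Q ⊆ P.1} ≤ #(powersetCard (p - #Q) Qᶜ) := by
    refine card_le_card_of_injOn (fun P => P.1 \ Q) ?_ ?_
    · intro P hP
      have hP := (mem_filter.1 hP).2
      rw [mem_coe, mem_powersetCard, card_sdiff_of_subset hP, P.2]
      exact ⟨fun x hx => mem_compl.2 (Finset.mem_sdiff.1 hx).2, rfl⟩
    · intro P hP P' hP' h
      have hP := (mem_filter.1 hP).2
      have hP' := (mem_filter.1 hP').2
      apply Subtype.ext
      rw [← sdiff_union_of_subset hP, ← sdiff_union_of_subset hP']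
      exact congrArg (· ∪ Q) h
  rcases le_or_gt #Q p with hq | hq
  · rw [card_powersetCard, card_compl, Fintype.card_fin] at h1
    have h2 := Nat.choose_mul (n := m) hq
    have h3 : (m - #Q).choose (p - #Q) * m.descFactorial #Q = m.choose p * p.descFactorial #Q := by
      rw [Nat.descFactorial_eq_factorial_mul_choose, Nat.descFactorial_eq_factorial_mul_choose]
      rw [mul_left_comm, mul_comm ((m - #Q).choose (p - #Q)), ← h2]
      ring
    have hpos : (0 : ℝ) < m.descFactorial #Q := by
      exact_mod_cast Nat.pos_of_ne_zero fun h =>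
        absurd (Nat.descFactorial_eq_zero_iff_lt.1 h) (by omega)
    calc (#{P : PortSet m p | Q ⊆ P.1} : ℝ) ≤ ((m - #Q).choose (p - #Q) : ℕ) := by exact_mod_cast h1
      _ = m.choose p * descRatio p m #Q := by
        rw [descRatio, mul_div_assoc', eq_div_iff hpos.ne']
        exact_mod_cast h3
      _ ≤ _ := by gcongr; exact descRatio_le_pow hp _
  · have : #{P : PortSet m p | Q ⊆ P.1} = 0 := by
      rw [card_eq_zero, filter_eq_empty_iff]
      intro P _ h
      have := card_le_card h
      rw [P.2] at this
      omega
    rw [this, Nat.cast_zero]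
    positivity

end Counting

/-! ### The probability of a trap at a given place -/

section Probability

open Finset
open scoped Classical

variable {m p dIn dOut : ℕ}

/-- The number of choices of the matchings once the ports are chosen. -/
theorem card_gadgetOutcome_fiber (P : PortSet m p × PortSet m p) :
    Fintype.card ((Fin dIn → (Fin m ≃ Fin m)) ×
      (Fin dOut → ({x : Fin m // x ∉ P.1.1} ≃ {y : Fin m // y ∉ P.2.1}))) =
      m.factorial ^ dIn * (m - p).factorial ^ dOut := by
  have h : ∀ P : PortSet m p, Fintype.card {x : Fin m // x ∉ P.1} = m - p := by
    intro P
    rw [Fintype.card_subtype_compl, Fintype.card_fin, Fintype.card_coe, P.2]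
  rw [Fintype.card_prod, Fintype.card_fun, Fintype.card_fun, Fintype.card_fin, Fintype.card_fin,
    Fintype.card_equiv (Equiv.refl _), Fintype.card_fin,
    Fintype.card_equiv (Fintype.equivOfCardEq ((h P.1).trans (h P.2).symm)), h]

theorem card_gadgetOutcome : Fintype.card (GadgetOutcome m p dIn dOut) =
    m.choose p * m.choose p * (m.factorial ^ dIn * (m - p).factorial ^ dOut) := by
  rw [Fintype.card_sigma]
  simp only [card_gadgetOutcome_fiber]
  rw [sum_const, card_univ, Fintype.card_prod, card_portSet, smul_eq_mul]

theorem gadgetProb_eq_ncard_div (E : Set (GadgetOutcome m p dIn dOut)) :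
    gadgetProb m p dIn dOut E = E.ncard /
      ((m.choose p * m.choose p * (m.factorial ^ dIn * (m - p).factorial ^ dOut) : ℕ) : ℝ) := by
  rw [gadgetProb, card_gadgetOutcome]
  congr 2
  rw [← Set.ncard_coe_finset]
  congr 1
  ext g
  simp

theorem gadgetProb_mono {E F : Set (GadgetOutcome m p dIn dOut)} (h : E ⊆ F) :
    gadgetProb m p dIn dOut E ≤ gadgetProb m p dIn dOut F := by
  rw [gadgetProb_eq_ncard_div, gadgetProb_eq_ncard_div]
  gcongr
  exact Set.toFinite F

theorem gadgetProb_nonneg (E : Set (GadgetOutcome m p dIn dOut)) :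
    0 ≤ gadgetProb m p dIn dOut E := by
  unfold gadgetProb; positivity

theorem gadgetProb_union_le (E F : Set (GadgetOutcome m p dIn dOut)) :
    gadgetProb m p dIn dOut (E ∪ F) ≤ gadgetProb m p dIn dOut E + gadgetProb m p dIn dOut F := by
  rw [gadgetProb_eq_ncard_div, gadgetProb_eq_ncard_div, gadgetProb_eq_ncard_div, ← add_div]
  gcongr
  exact_mod_cast Set.ncard_union_le E F

theorem gadgetProb_biUnion_le {ι : Type*} (s : Finset ι)
    (E : ι → Set (GadgetOutcome m p dIn dOut)) :
    gadgetProb m p dIn dOut (⋃ i ∈ s, E i) ≤ ∑ i ∈ s, gadgetProb m p dIn dOut (E i) := by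
  induction s using Finset.induction_on with
  | empty => simp [gadgetProb_eq_ncard_div]
  | insert i s hi ih =>
    rw [sum_insert hi, set_biUnion_insert]
    exact (gadgetProb_union_le _ _).trans (by gcongr)

theorem one_sub_gadgetProb_le (hp : p ≤ m) {E F : Set (GadgetOutcome m p dIn dOut)}
    (h : ∀ g, g ∉ F → g ∈ E) : 1 - gadgetProb m p dIn dOut F ≤ gadgetProb m p dIn dOut E := by
  have huniv : gadgetProb m p dIn dOut Set.univ = 1 := by
    rw [gadgetProb_eq_ncard_div, Set.ncard_univ, Nat.card_eq_fintype_card, card_gadgetOutcome]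
    refine div_self ?_
    have := Nat.choose_pos hp
    positivity
  rw [sub_le_iff_le_add, ← huniv]
  refine (gadgetProb_mono fun g _ => ?_).trans (gadgetProb_union_le E F)
  by_cases hg : g ∈ F
  exacts [Or.inr hg, Or.inl (h g hg)]

/-- Two coordinates of a uniformly random function are independent; `N` is the number of values
and `r`, `s` are the probabilities of `E`, `F`. -/
theorem ncard_fun_two_coordinates_le {ι α : Type*} [Fintype ι] [Finite α] {a b : ι} (hab : a ≠ b)
    (E F : Set α) {N r s : ℝ} (hN : (Nat.card α : ℝ) ≤ N) (hE : (E.ncard : ℝ) ≤ N * r)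
    (hF : (F.ncard : ℝ) ≤ N * s) :
    ({f : ι → α | f a ∈ E ∧ f b ∈ F}.ncard : ℝ) ≤ N ^ Fintype.card ι * (r * s) := by
  have := Fintype.ofFinite α
  rw [Nat.card_eq_fintype_card] at hN
  rw [Set.ncard_eq_toFinset_card'] at hE hF
  have h1 : {f : ι → α | f a ∈ E ∧ f b ∈ F} =
      (Fintype.piFinset fun c => if c = a then E.toFinset else
        if c = b then F.toFinset else univ : Finset (ι → α)) := by
    ext f
    simp only [mem_coe, Fintype.mem_piFinset]
    constructor
    · rintro ⟨ha, hb⟩ c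
      split_ifs with h h'
      exacts [Set.mem_toFinset.2 (h ▸ ha), Set.mem_toFinset.2 (h' ▸ hb), mem_univ _]
    · intro h
      have ha := h a
      have hb := h b
      rw [if_pos rfl] at ha
      rw [if_neg hab.symm, if_pos rfl] at hb
      exact ⟨Set.mem_toFinset.1 ha, Set.mem_toFinset.1 hb⟩
  rw [h1, Set.ncard_coe_finset, Fintype.card_piFinset]
  push_cast
  calc _ ≤ ∏ c : ι, N * ((if c = a then r else 1) * (if c = b then s else 1)) := by
        refine prod_le_prod (fun _ _ => by positivity) fun c _ => ?_
        by_cases ha : c = a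
        · subst ha
          simpa [hab] using hE
        · by_cases hb : c = b
          · subst hb
            simpa [hab.symm] using hF
          · simpa [ha, hb] using hN
    _ = _ := by
      rw [prod_mul_distrib, prod_mul_distrib, prod_const, card_univ]
      simp

theorem ncard_outMatching_le (P : PortSet m p × PortSet m p) (X B : Finset (Fin m)) :
    ({h : Fin 1 → ({x : Fin m // x ∉ P.1.1} ≃ {y : Fin m // y ∉ P.2.1}) |
      ∀ x ∈ X, ∃ y ∈ B, ∃ hx : x ∉ P.1.1, (h 0 ⟨x, hx⟩ : Fin m) = y}.ncard : ℝ) ≤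
      (m - p).factorial * descRatio #B (m - p) #X := by
  have hcard : ∀ P : PortSet m p, Fintype.card {x : Fin m // x ∉ P.1} = m - p := by
    intro P
    rw [Fintype.card_subtype_compl, Fintype.card_fin, Fintype.card_coe, P.2]
  by_cases hX : ∀ x ∈ X, x ∉ P.1.1
  · have h1 := card_equiv_mapsTo_le (hcard P.1) (hcard P.2) (X.subtype (· ∉ P.1.1))
      (B.subtype (· ∉ P.2.1))
    have hXc : #(X.subtype (· ∉ P.1.1)) = #X := by
      rw [card_subtype, filter_true_of_mem hX]
    have hBc : #(B.subtype (· ∉ P.2.1)) ≤ #B := by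
      rw [card_subtype]
      exact card_filter_le _ _
    rw [hXc] at h1
    refine le_trans ?_ (h1.trans (mul_le_mul_of_nonneg_left (descRatio_mono hBc _ _)
      (Nat.cast_nonneg _)))
    rw [Nat.cast_le]
    refine Set.ncard_le_ncard_of_injOn (fun h => h 0) ?_ ?_
    · intro h hh z hz
      obtain ⟨y, hy, hx, e⟩ := hh z (mem_subtype.1 hz)
      rw [mem_subtype]
      exact e ▸ hy
    · intro h _ h' _ e
      funext i
      rw [Subsingleton.elim i 0]
      exact e
  · refine le_of_eq_of_le (Nat.cast_eq_zero.2 ?_)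
      (mul_nonneg (by positivity) (descRatio_nonneg _ _ _))
    rw [Set.ncard_eq_zero (Set.toFinite _), Set.eq_empty_iff_forall_notMem]
    intro h hh
    exact hX fun x hx => by
      obtain ⟨_, _, h, _⟩ := hh x hx
      exact h

/-- The sets of ports on the two sides, and given these the matchings, are independent. -/
theorem gadgetProb_traps_le (hp : p ≤ m) {a b : Fin dIn} (hab : a ≠ b)
    (Q₁ Q₂ X₀ X₁ X₂ B : Finset (Fin m)) :
    gadgetProb m p dIn 1 {g | g.Traps a b Q₁ Q₂ X₀ X₁ X₂ B} ≤
      ((p : ℝ) / m) ^ #Q₁ * ((p : ℝ) / m) ^ #Q₂ *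
        (descRatio #B m #X₀ * descRatio #B m #X₁ * descRatio #B (m - p) #X₂) := by
  set r := descRatio #B m #X₀ * descRatio #B m #X₁ * descRatio #B (m - p) #X₂ with hr
  have hr0 : 0 ≤ r :=
    mul_nonneg (mul_nonneg (descRatio_nonneg _ _ _) (descRatio_nonneg _ _ _)) (descRatio_nonneg _ _ _)
  set N : ℝ := (m.factorial : ℝ) ^ dIn * (m - p).factorial with hN
  have hN0 : 0 ≤ N := by positivity
  have hpos : (0 : ℝ) < m.choose p := by exact_mod_cast Nat.choose_pos hp
  -- the matchings are independent given the ports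
  have hfiber : ∀ P : PortSet m p × PortSet m p,
      ({q | GadgetOutcome.Traps (⟨P, q⟩ : GadgetOutcome m p dIn 1) a b Q₁ Q₂ X₀ X₁ X₂ B}.ncard : ℝ) ≤
      if Q₁ ⊆ P.1.1 ∧ Q₂ ⊆ P.2.1 then N * r else 0 := by
    intro P
    split_ifs with hP
    · have hsub : {q | GadgetOutcome.Traps (⟨P, q⟩ : GadgetOutcome m p dIn 1) a b Q₁ Q₂ X₀ X₁ X₂ B} ⊆
          {f : Fin dIn → (Fin m ≃ Fin m) | f a ∈ {e : Fin m ≃ Fin m | ∀ z ∈ X₀, e z ∈ B} ∧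
            f b ∈ {e : Fin m ≃ Fin m | ∀ z ∈ X₁, e z ∈ B}} ×ˢ
          {h : Fin 1 → ({x : Fin m // x ∉ P.1.1} ≃ {y : Fin m // y ∉ P.2.1}) |
            ∀ x ∈ X₂, ∃ y ∈ B, ∃ hx : x ∉ P.1.1, (h 0 ⟨x, hx⟩ : Fin m) = y} := by
        rintro ⟨f, h⟩ hq
        exact ⟨⟨hq.fst, hq.snd⟩, GadgetOutcome.Traps.out hq⟩
      refine (Nat.cast_le.2 (Set.ncard_le_ncard hsub (Set.toFinite _))).trans ?_
      rw [Set.ncard_prod, Nat.cast_mul]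
      have h1 := ncard_fun_two_coordinates_le hab _ _
        (by rw [Nat.card_eq_fintype_card, Fintype.card_equiv (Equiv.refl _), Fintype.card_fin])
        (card_equiv_mapsTo_le (Fintype.card_fin m) (Fintype.card_fin m) X₀ B)
        (card_equiv_mapsTo_le (Fintype.card_fin m) (Fintype.card_fin m) X₁ B)
      have h2 := ncard_outMatching_le P X₂ B
      rw [Fintype.card_fin] at h1
      refine (mul_le_mul h1 h2 (Nat.cast_nonneg _) ?_).trans (le_of_eq ?_)
      · exact mul_nonneg (by positivity) (mul_nonneg (descRatio_nonneg _ _ _)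
          (descRatio_nonneg _ _ _))
      · rw [hN, hr]; ring
    · refine le_of_eq (Nat.cast_eq_zero.2 ?_)
      rw [Set.ncard_eq_zero (Set.toFinite _), Set.eq_empty_iff_forall_notMem]
      exact fun q hq => hP ⟨hq.portLeft, hq.portRight⟩
  have hcount : ({g : GadgetOutcome m p dIn 1 | g.Traps a b Q₁ Q₂ X₀ X₁ X₂ B}.ncard : ℝ) ≤
      ∑ P : PortSet m p × PortSet m p, if Q₁ ⊆ P.1.1 ∧ Q₂ ⊆ P.2.1 then N * r else 0 := by
    refine le_trans (le_of_eq ?_) (sum_le_sum fun P _ => hfiber P)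
    rw [← Nat.cast_sum, Nat.cast_inj]
    simp_rw [← Nat.card_coe_set_eq]
    rw [← Nat.card_sigma]
    exact Nat.card_congr
      { toFun := fun g => ⟨g.1.1, ⟨g.1.2, g.2⟩⟩
        invFun := fun g => ⟨⟨g.1, g.2.1⟩, g.2.2⟩
        left_inv := fun g => rfl
        right_inv := fun g => rfl }
  have hports : (∑ P : PortSet m p × PortSet m p, if Q₁ ⊆ P.1.1 ∧ Q₂ ⊆ P.2.1 then N * r else 0) ≤
      (m.choose p * ((p : ℝ) / m) ^ #Q₁) * (m.choose p * ((p : ℝ) / m) ^ #Q₂) * (N * r) := by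
    rw [← sum_filter, sum_const, nsmul_eq_mul]
    have : #({P : PortSet m p × PortSet m p | Q₁ ⊆ P.1.1 ∧ Q₂ ⊆ P.2.1} : Finset _) =
        {P : PortSet m p | Q₁ ⊆ P.1}.ncard * {P : PortSet m p | Q₂ ⊆ P.1}.ncard := by
      rw [← Set.ncard_prod, ← Set.ncard_coe_finset, coe_filter_univ]
      rfl
    rw [this, Nat.cast_mul]
    gcongr
    · exact card_portSet_superset_le hp Q₁
    · exact card_portSet_superset_le hp Q₂
  rw [gadgetProb_eq_ncard_div, div_le_iff₀ (by push_cast; positivity)]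
  refine (hcount.trans hports).trans (le_of_eq ?_)
  push_cast
  rw [hN]
  ring

end Probability

/-! ### Union bounds over all traps -/

section UnionBounds

open Finset
open scoped Classical

variable {m p dIn : ℕ}

theorem gadgetProb_biUnion_le_card_mul {dOut : ℕ} {ι : Type*} {s : Finset ι}
    {E : ι → Set (GadgetOutcome m p dIn dOut)} {c : ℝ}
    (h : ∀ i ∈ s, gadgetProb m p dIn dOut (E i) ≤ c) :
    gadgetProb m p dIn dOut (⋃ i ∈ s, E i) ≤ #s * c := by
  refine (gadgetProb_biUnion_le s E).trans ((sum_le_card_nsmul _ _ _ h).trans ?_)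
  rw [nsmul_eq_mul]

/-- Each port or matching edge of a trap costs a factor `ρ`. For a given set `S` there are at most
`16 ^ |S|` choices of the trap, so summing over `S ≠ ∅` gives the binomial expansion of
`(1 + 16 w) ^ (2 m)` without its constant term, where `w = ρ ^ (17 / 12)`. -/
theorem gadgetProb_hasSmallTrap_le (hp : p ≤ m) {a b : Fin dIn} (hab : a ≠ b) {t : ℕ} {ρ : ℝ}
    (hρ0 : 0 < ρ) (hρ1 : ρ ≤ 1) (hpρ : (p : ℝ) / m ≤ ρ) (ht : t ≤ m - p)
    (htρ : (t : ℝ) / (m - p : ℕ) ≤ ρ) :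
    gadgetProb m p dIn 1 {g | g.HasSmallTrap a b t} ≤
      (1 + 16 * ρ ^ (17 / 12 : ℝ)) ^ (2 * m) - 1 := by
  set w := ρ ^ (17 / 12 : ℝ) with hw
  have hw0 : 0 < w := Real.rpow_pos_of_pos hρ0 _
  have hpow : ∀ s e : ℕ, 17 * s ≤ 12 * e → ρ ^ e ≤ w ^ s := by
    intro s e h
    rw [hw, ← Real.rpow_mul_natCast hρ0.le, ← Real.rpow_natCast]
    refine Real.rpow_le_rpow_of_exponent_ge hρ0 hρ1 ?_
    have : (17 * s : ℝ) ≤ 12 * e := by exact_mod_cast h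
    linarith
  have hbound : ∀ b k : ℕ, b ≤ t → descRatio b (m - p) k ≤ ρ ^ k := by
    intro b k hb
    refine (descRatio_le_pow (hb.trans ht) k).trans (pow_le_pow_left₀ (by positivity) ?_ k)
    exact le_trans (by gcongr) htρ
  have hbound' : ∀ b k : ℕ, b ≤ t → descRatio b m k ≤ ρ ^ k := by
    intro b k hb
    refine (descRatio_le_pow (by omega) k).trans (pow_le_pow_left₀ (by positivity) ?_ k)
    refine le_trans ?_ htρ
    rcases Nat.eq_zero_or_pos (m - p) with h0 | h0
    · have : b = 0 := by omega
      rw [this, Nat.cast_zero, zero_div]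
      positivity
    · have : (0 : ℝ) < (m - p : ℕ) := by exact_mod_cast h0
      gcongr
      omega
  let I : Finset (GadgetVertex m) →
      Finset (Finset (Fin m) × Finset (Fin m) × Finset (Fin m) × Finset (Fin m) × Finset (Fin m)) :=
    fun S => S.toLeft.powerset ×ˢ S.toRight.powerset ×ˢ S.toLeft.powerset ×ˢ S.toLeft.powerset ×ˢ
      S.toLeft.powerset
  have hsub : {g : GadgetOutcome m p dIn 1 | g.HasSmallTrap a b t} ⊆
      ⋃ S ∈ ({S | S.Nonempty ∧ #S ≤ t} : Finset (Finset (GadgetVertex m))),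
        ⋃ q ∈ {q ∈ I S | 17 * #S ≤ 12 * (#q.1 + #q.2.1 + #q.2.2.1 + #q.2.2.2.1 + #q.2.2.2.2)},
          {g | g.Traps a b q.1 q.2.1 q.2.2.1 q.2.2.2.1 q.2.2.2.2 S.toRight} := by
    rintro g ⟨S, hS, hSt, Q₁, h1, Q₂, h2, X₀, h3, X₁, h4, X₂, h5, hs, hg⟩
    simp only [Set.mem_iUnion]
    refine ⟨S, mem_filter.2 ⟨mem_univ _, hS, hSt⟩, (Q₁, Q₂, X₀, X₁, X₂),
      mem_filter.2 ⟨?_, hs⟩, hg⟩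
    simp only [I, mem_product, mem_powerset]
    exact ⟨h1, h2, h3, h4, h5⟩
  refine (gadgetProb_mono hsub).trans ((gadgetProb_biUnion_le _ _).trans ?_)
  have hS : ∀ S ∈ ({S | S.Nonempty ∧ #S ≤ t} : Finset (Finset (GadgetVertex m))),
      gadgetProb m p dIn 1
        (⋃ q ∈ {q ∈ I S | 17 * #S ≤ 12 * (#q.1 + #q.2.1 + #q.2.2.1 + #q.2.2.2.1 + #q.2.2.2.2)},
          {g | g.Traps a b q.1 q.2.1 q.2.2.1 q.2.2.2.1 q.2.2.2.2 S.toRight}) ≤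
        (16 * w) ^ #S := by
    intro S hS
    obtain ⟨-, -, hSt⟩ := mem_filter.1 hS
    have hc := card_toLeft_add_card_toRight (u := S)
    have hcard : #({q ∈ I S | 17 * #S ≤
        12 * (#q.1 + #q.2.1 + #q.2.2.1 + #q.2.2.2.1 + #q.2.2.2.2)}) ≤ 16 ^ #S := by
      refine (card_filter_le _ _).trans ?_
      simp only [I, card_product, card_powerset]
      calc _ = 16 ^ #S.toLeft * 2 ^ #S.toRight := by
            rw [show 16 = 2 * (2 * (2 * 2)) by norm_num, mul_pow, mul_pow, mul_pow]; ring
        _ ≤ 16 ^ #S.toLeft * 16 ^ #S.toRight := by gcongr; norm_num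
        _ = 16 ^ #S := by rw [← pow_add, hc]
    refine (gadgetProb_biUnion_le_card_mul (c := w ^ #S) fun q hq => ?_).trans ?_
    · refine (gadgetProb_traps_le hp hab _ _ _ _ _ _).trans ?_
      refine le_trans ?_ (hpow _ _ (mem_filter.1 hq).2)
      have hB : #S.toRight ≤ t := by omega
      calc _ ≤ ρ ^ #q.1 * ρ ^ #q.2.1 * (ρ ^ #q.2.2.1 * ρ ^ #q.2.2.2.1 * ρ ^ #q.2.2.2.2) := by
            have h1 := hbound' _ #q.2.2.1 hB
            have h2 := hbound' _ #q.2.2.2.1 hB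
            have h3 := hbound _ #q.2.2.2.2 hB
            have n1 := descRatio_nonneg #S.toRight m #q.2.2.1
            have n2 := descRatio_nonneg #S.toRight m #q.2.2.2.1
            have n3 := descRatio_nonneg #S.toRight (m - p) #q.2.2.2.2
            gcongr
        _ = _ := by ring
    · rw [mul_pow]
      gcongr
      exact_mod_cast hcard
  refine (sum_le_sum hS).trans ?_
  have htot := Fintype.sum_pow_mul_eq_add_pow (GadgetVertex m) (16 * w) 1
  simp only [one_pow, mul_one, Fintype.card_sum, Fintype.card_fin] at htot
  rw [add_comm (1 : ℝ), two_mul, ← htot, le_sub_iff_add_le, ← add_sum_erase univ _ (mem_univ ∅),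
    card_empty, pow_zero, add_comm]
  gcongr
  intro S hS
  exact mem_erase.2 ⟨(mem_filter.1 hS).2.1.ne_empty, mem_univ _⟩

/-- A single term of the binomial expansion, used to bound binomial coefficients by choosing
`t`. -/
theorem choose_mul_pow_le_one_add_pow {t : ℝ} (ht : 0 ≤ t) (n j : ℕ) :
    (n.choose j : ℝ) * t ^ j ≤ (1 + t) ^ n := by
  rcases le_or_gt j n with h | h
  · rw [add_comm, add_pow]
    refine le_trans (le_of_eq ?_) (single_le_sum (f := fun i => t ^ i * 1 ^ (n - i) * (n.choose i : ℝ))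
      (fun i _ => by positivity) (mem_range.2 (Nat.lt_succ_of_le h)))
    simp only [one_pow]
    ring
  · rw [Nat.choose_eq_zero_of_lt h]
    simp only [Nat.cast_zero, zero_mul]
    positivity

/-- The entropy estimate behind the expansion of large sets. The factor
`(k / (m - p)) ^ (k - k / 200)`, essentially at most `2 ^ (-k)`, beats the binomial coefficients,
whose lower entries are at most `k / 200` after reflection. -/
theorem choose_sq_mul_choose_mul_pow_le {k : ℕ} (hk : 1 ≤ k) (hkm : 2 * k ≤ m)
    (hpm : 100 * p ≤ m) :
    (k.choose (k - k / 200) : ℝ) ^ 2 * (m - (k - k / 200)).choose (k / 200) *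
      ((k : ℝ) / (m - p : ℕ)) ^ (k - k / 200) ≤ (7 / 10) ^ k := by
  set j := k / 200 with hj
  have hjk : 200 * j ≤ k := Nat.mul_div_le k 200
  have hk0 : (0 : ℝ) < k := by exact_mod_cast hk
  have hm0 : (0 : ℝ) < m := by
    have : 0 < m := by omega
    exact_mod_cast this
  have hkm' : 2 * (k : ℝ) ≤ m := by exact_mod_cast hkm
  have hpm' : 100 * (p : ℝ) ≤ m := by exact_mod_cast hpm
  have hp0 : (0 : ℝ) ≤ p := by positivity
  have hcast : ((m - p : ℕ) : ℝ) = m - p := Nat.cast_sub (by omega)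
  set r : ℝ := (k : ℝ) / (m - p : ℕ) with hr
  have hr0 : 0 < r := by rw [hr, hcast]; exact div_pos hk0 (by linarith)
  have hr1 : r ≤ 51 / 100 := by
    rw [hr, hcast, div_le_iff₀ (by linarith)]
    linarith
  have h1 : (k.choose (k - j) : ℝ) ≤ (65 / 64) ^ k * 64 ^ j := by
    rw [Nat.choose_symm (by omega)]
    have := choose_mul_pow_le_one_add_pow (t := 1 / 64) (by norm_num) k j
    rw [one_div, inv_pow, ← div_eq_mul_inv, div_le_iff₀ (by positivity)] at this
    norm_num at this ⊢
    exact this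
  have h2 : ((m - (k - j)).choose j : ℝ) ≤ (32 / 31) ^ k * (33 / r) ^ j := by
    -- this `t` makes the first factor exponential in `k` rather than in `m`
    have h := choose_mul_pow_le_one_add_pow (t := k / (32 * m)) (by positivity) (m - (k - j)) j
    have hexp : (1 + (k : ℝ) / (32 * m)) ^ (m - (k - j)) ≤ (32 / 31) ^ k := by
      calc _ ≤ (1 + (k : ℝ) / (32 * m)) ^ m :=
            pow_le_pow_right₀ (by linarith [show 0 ≤ (k : ℝ) / (32 * m) by positivity]) (by omega)
        _ ≤ Real.exp ((k : ℝ) / (32 * m)) ^ m := by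
            refine pow_le_pow_left₀ (by positivity) ?_ m
            rw [add_comm]
            exact Real.add_one_le_exp _
        _ = Real.exp (1 / 32) ^ k := by
            rw [← Real.exp_nat_mul, ← Real.exp_nat_mul]
            congr 1
            field_simp
        _ ≤ (32 / 31) ^ k := by
            refine pow_le_pow_left₀ (Real.exp_pos _).le ?_ k
            have := Real.one_sub_le_exp_neg (1 / 32)
            rw [Real.exp_neg, le_inv_comm₀ (by norm_num) (Real.exp_pos _)] at this
            norm_num at this ⊢
            exact this
    have hinv : (1 : ℝ) ≤ (k / (32 * m)) * (33 / r) := by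
      have : (k / (32 * m)) * (33 / r) = 33 * ((m : ℝ) - p) / (32 * m) := by
        rw [hr, hcast]
        have : (m : ℝ) - p ≠ 0 := by linarith
        field_simp
      rw [this, one_le_div (by positivity)]
      linarith
    calc ((m - (k - j)).choose j : ℝ)
        ≤ (m - (k - j)).choose j * ((k / (32 * m)) * (33 / r)) ^ j :=
          le_mul_of_one_le_right (by positivity) (one_le_pow₀ hinv)
      _ = (m - (k - j)).choose j * (k / (32 * m)) ^ j * (33 / r) ^ j := by rw [mul_pow]; ring
      _ ≤ _ := by gcongr; exact h.trans hexp
  have h3 : r ^ (k - j) * (33 / r) ^ j ≤ (51 / 100) ^ k * 132 ^ j := by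
    have e1 : r ^ (k - j) * (33 / r) ^ j = 33 ^ j * r ^ (k - 2 * j) := by
      rw [show k - j = (k - 2 * j) + j by omega, pow_add, mul_assoc, ← mul_pow,
        mul_div_cancel₀ _ hr0.ne', mul_comm]
    have e2 : r ^ (k - 2 * j) ≤ (51 / 100) ^ k * 4 ^ j := by
      calc r ^ (k - 2 * j) ≤ (51 / 100) ^ (k - 2 * j) := pow_le_pow_left₀ hr0.le hr1 _
        _ ≤ (51 / 100) ^ (k - 2 * j) * ((51 / 100) ^ 2 * 4) ^ j :=
            le_mul_of_one_le_right (by positivity) (one_le_pow₀ (by norm_num))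
        _ = (51 / 100) ^ (k - 2 * j + 2 * j) * 4 ^ j := by rw [mul_pow, ← pow_mul, pow_add]; ring
        _ = _ := by rw [Nat.sub_add_cancel (by omega)]
    rw [e1, show (132 : ℝ) = 33 * 4 by norm_num, mul_pow]
    calc (33 : ℝ) ^ j * r ^ (k - 2 * j) ≤ 33 ^ j * ((51 / 100) ^ k * 4 ^ j) := by gcongr
      _ = _ := by ring
  have h4 : (540672 : ℝ) ^ j ≤ (11 / 10) ^ k := by
    calc (540672 : ℝ) ^ j ≤ ((11 / 10) ^ 200) ^ j := by gcongr; norm_num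
      _ = (11 / 10) ^ (200 * j) := by rw [pow_mul]
      _ ≤ _ := pow_le_pow_right₀ (by norm_num) hjk
  calc _ ≤ ((65 / 64) ^ k * 64 ^ j : ℝ) ^ 2 * ((32 / 31) ^ k * (33 / r) ^ j) * r ^ (k - j) := by
        gcongr
    _ = ((65 / 64) ^ k * 64 ^ j : ℝ) ^ 2 * (32 / 31) ^ k * (r ^ (k - j) * (33 / r) ^ j) := by ring
    _ ≤ ((65 / 64) ^ k * 64 ^ j : ℝ) ^ 2 * (32 / 31) ^ k * ((51 / 100) ^ k * 132 ^ j) := by gcongr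
    _ = ((65 / 64) ^ 2 * (32 / 31) * (51 / 100) : ℝ) ^ k * 540672 ^ j := by
        rw [show (540672 : ℝ) = 64 ^ 2 * 132 by norm_num]
        simp only [mul_pow, ← pow_mul]
        ring
    _ ≤ ((65 / 64) ^ 2 * (32 / 31) * (51 / 100) : ℝ) ^ k * (11 / 10) ^ k := by gcongr
    _ = ((65 / 64) ^ 2 * (32 / 31) * (51 / 100) * (11 / 10) : ℝ) ^ k := by rw [mul_pow _ (11 / 10)]
    _ ≤ (7 / 10) ^ k := pow_le_pow_left₀ (by norm_num) (by norm_num) k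

theorem descRatio_eq_choose_div (b n k : ℕ) : descRatio b n k = (b.choose k : ℝ) / n.choose k := by
  rw [descRatio, Nat.descFactorial_eq_factorial_mul_choose,
    Nat.descFactorial_eq_factorial_mul_choose]
  push_cast
  rw [mul_div_mul_left _ _ (by positivity)]

/-- There are `C(m, k) ^ 2` pairs of sets of size `k`, and two of the three matchings contribute
factors of about `C(m, k)⁻¹` each, so the third one, which contributes at most about
`(k / (m - p)) ^ k`, makes the sum converge. -/
theorem gadgetProb_hasLargeTrap_le (hpm : 100 * p ≤ m) {a b : Fin dIn} (hab : a ≠ b) {n : ℕ}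
    (hn : 1 ≤ n) :
    gadgetProb m p dIn 1 {g | g.HasLargeTrap a b n} ≤ (7 / 10) ^ n / (1 - 7 / 10) := by
  have hp : p ≤ m := by omega
  have hsub : {g : GadgetOutcome m p dIn 1 | g.HasLargeTrap a b n} ⊆
      ⋃ k ∈ {k ∈ Ico n (m + 1) | 2 * k ≤ m},
        ⋃ X ∈ powersetCard k (univ : Finset (Fin m)), ⋃ Y ∈ powersetCard k (univ : Finset (Fin m)),
          ⋃ X₁ ∈ powersetCard (k - k / 200) X, ⋃ X₂ ∈ powersetCard (k - k / 200) X,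
            {g | g.Traps a b ∅ ∅ X X₁ X₂ Y} := by
    rintro g ⟨k, hnk, hkm, X, Y, hX, hY, X₁, h1, X₂, h2, h1', h2', hg⟩
    simp only [Set.mem_iUnion]
    exact ⟨k, mem_filter.2 ⟨mem_Ico.2 ⟨hnk, by omega⟩, hkm⟩,
      X, mem_powersetCard.2 ⟨subset_univ _, hX⟩, Y, mem_powersetCard.2 ⟨subset_univ _, hY⟩,
      X₁, mem_powersetCard.2 ⟨h1, h1'⟩, X₂, mem_powersetCard.2 ⟨h2, h2'⟩, hg⟩
  refine (gadgetProb_mono hsub).trans ((gadgetProb_biUnion_le _ _).trans ?_)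
  refine le_trans ?_ (geom_sum_Ico_le_of_lt_one (m := n) (n := m + 1) (x := (7 / 10 : ℝ))
    (by norm_num) (by norm_num))
  refine le_trans (sum_le_sum fun k hk => ?_)
    (sum_le_sum_of_subset_of_nonneg (filter_subset _ _) fun _ _ _ => by positivity)
  obtain ⟨hk, hkm⟩ := mem_filter.1 hk
  have hk1 : 1 ≤ k := hn.trans (mem_Ico.1 hk).1
  set l := k - k / 200 with hl
  have hlk : l ≤ k := Nat.sub_le _ _
  set c : ℝ := (m.choose k : ℝ)⁻¹ * ((k.choose l : ℝ) / m.choose l) *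
    ((k : ℝ) / (m - p : ℕ)) ^ l with hc
  have htrap : ∀ X ∈ powersetCard k (univ : Finset (Fin m)),
      ∀ Y ∈ powersetCard k (univ : Finset (Fin m)), ∀ X₁ ∈ powersetCard l X,
        ∀ X₂ ∈ powersetCard l X,
          gadgetProb m p dIn 1 {g | g.Traps a b ∅ ∅ X X₁ X₂ Y} ≤ c := by
    intro X hX Y hY X₁ h1 X₂ h2
    refine (gadgetProb_traps_le hp hab _ _ _ _ _ _).trans ?_
    rw [(mem_powersetCard.1 hX).2, (mem_powersetCard.1 hY).2, (mem_powersetCard.1 h1).2,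
      (mem_powersetCard.1 h2).2, card_empty, pow_zero, mul_one, one_mul,
      descRatio_eq_choose_div k m k, descRatio_eq_choose_div k m l, Nat.choose_self, Nat.cast_one,
      one_div]
    refine mul_le_mul_of_nonneg_left (descRatio_le_pow (by omega) l) (by positivity)
  have hunion : ∀ X ∈ powersetCard k (univ : Finset (Fin m)),
      ∀ Y ∈ powersetCard k (univ : Finset (Fin m)),
        gadgetProb m p dIn 1 (⋃ X₁ ∈ powersetCard l X, ⋃ X₂ ∈ powersetCard l X,
            {g | g.Traps a b ∅ ∅ X X₁ X₂ Y}) ≤ k.choose l * (k.choose l * c) := by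
    intro X hX Y hY
    have hcard : #(powersetCard l X) = k.choose l := by
      rw [card_powersetCard, (mem_powersetCard.1 hX).2]
    have h := gadgetProb_biUnion_le_card_mul fun X₁ h1 =>
      gadgetProb_biUnion_le_card_mul (htrap X hX Y hY X₁ h1)
    rwa [hcard] at h
  have hall := gadgetProb_biUnion_le_card_mul fun X hX =>
    gadgetProb_biUnion_le_card_mul (hunion X hX)
  rw [card_powersetCard, card_univ, Fintype.card_fin] at hall
  refine hall.trans (le_trans (le_of_eq ?_) (choose_sq_mul_choose_mul_pow_le hk1 hkm hpm))
  have hmk : (m.choose k : ℝ) ≠ 0 := by exact_mod_cast (Nat.choose_pos (by omega)).ne'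
  have hml : (m.choose l : ℝ) ≠ 0 := by exact_mod_cast (Nat.choose_pos (by omega)).ne'
  have hmul : (m.choose k : ℝ) * k.choose l = m.choose l * (m - l).choose (k / 200) := by
    have := Nat.choose_mul (n := m) hlk
    rw [show k - l = k / 200 by omega] at this
    exact_mod_cast this
  rw [hc]
  field_simp
  rw [← hl]
  linear_combination (k.choose l : ℝ) ^ 2 * (k / (m - p : ℕ) : ℝ) ^ l * hmul

end UnionBounds

/-! ### Large gadgets expand -/

section Asymptotics

open Finset

theorem floor_rpow_le_floor_rpow {α : ℝ} (hα : α ≤ 1 / 4) {m : ℕ} (hm : 1 ≤ m) :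
    ⌊(m : ℝ) ^ α⌋₊ ≤ ⌊(m : ℝ) ^ (1 / 4 : ℝ)⌋₊ :=
  Nat.floor_le_floor (Real.rpow_le_rpow_of_exponent_le (by exact_mod_cast hm) hα)

/-- The bound on the probability that the gadget has a trap. With `ρ = 9624 m ^ (-3/4)`, small traps
contribute `exp (32 m ρ ^ (17/12)) - 1`, where `m ρ ^ (17/12)` is of order `m ^ (1 - 17/16)`. -/
noncomputable def trapBound (m : ℕ) : ℝ :=
  (Real.exp (32 * 9624 ^ (17 / 12 : ℝ) * (m : ℝ) ^ (-(1 / 16) : ℝ)) - 1) +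
    (7 / 10) ^ ⌊(m : ℝ) ^ (1 / 4 : ℝ)⌋₊ / (1 - 7 / 10)

theorem tendsto_floor_rpow : Tendsto (fun m : ℕ => ⌊(m : ℝ) ^ (1 / 4 : ℝ)⌋₊) atTop atTop :=
  tendsto_nat_floor_atTop.comp
    ((tendsto_rpow_atTop (by norm_num)).comp tendsto_natCast_atTop_atTop)

theorem tendsto_trapBound : Tendsto trapBound atTop (𝓝 0) := by
  have h1 : Tendsto (fun m : ℕ => (m : ℝ) ^ (-(1 / 16) : ℝ)) atTop (𝓝 0) :=
    (tendsto_rpow_neg_atTop (by norm_num)).comp tendsto_natCast_atTop_atTop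
  have h2 := ((h1.const_mul (32 * 9624 ^ (17 / 12 : ℝ))).rexp).sub_const 1
  have h3 := ((tendsto_pow_atTop_nhds_zero_of_lt_one (r := (7 / 10 : ℝ)) (by norm_num)
    (by norm_num)).comp tendsto_floor_rpow).div_const (1 - 7 / 10)
  unfold trapBound
  simpa using h2.add h3

theorem eventually_one_sub_trapBound_le :
    ∀ᶠ m : ℕ in atTop, ∀ p dIn : ℕ, p ≤ ⌊(m : ℝ) ^ (1 / 4 : ℝ)⌋₊ → 2 ≤ dIn →
      1 - trapBound m ≤ gadgetProb m p dIn 1 {g | g.Expands (1 / 1203)} := by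
  have hsmall : Tendsto (fun m : ℕ => 9624 * (m : ℝ) ^ (-(3 / 4) : ℝ)) atTop (𝓝 0) := by
    have h := ((tendsto_rpow_neg_atTop (y := 3 / 4) (by norm_num)).comp
      tendsto_natCast_atTop_atTop).const_mul (9624 : ℝ)
    simpa using h
  filter_upwards [hsmall.eventually_le_const one_pos, tendsto_floor_rpow.eventually_ge_atTop 1,
    eventually_ge_atTop 1] with m hρ1 hn1 hm1 p dIn hp hd
  set n := ⌊(m : ℝ) ^ (1 / 4 : ℝ)⌋₊ with hn
  -- `ρ` dominates both `p / m` and `4812 n / (m - p)`, as `p ≤ n ≤ m ^ (1/4)` and `m - p ≥ m / 2`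
  set ρ : ℝ := 9624 * (m : ℝ) ^ (-(3 / 4) : ℝ) with hρ
  have hm0 : (0 : ℝ) < m := by exact_mod_cast hm1
  have hρ0 : 0 < ρ := by positivity
  have hnρ : 9624 * (n : ℝ) ≤ ρ * m := by
    have h1 : (n : ℝ) ≤ (m : ℝ) ^ (1 / 4 : ℝ) := Nat.floor_le (by positivity)
    have h2 : (m : ℝ) ^ (-(3 / 4) : ℝ) * m = (m : ℝ) ^ (1 / 4 : ℝ) := by
      nth_rewrite 2 [← Real.rpow_one (m : ℝ)]
      rw [← Real.rpow_add hm0]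
      norm_num
    rw [hρ, mul_assoc, h2]
    linarith
  have hnm : 9624 * n ≤ m := by
    have : 9624 * (n : ℝ) ≤ m := hnρ.trans (by nlinarith)
    exact_mod_cast this
  have hpm : 100 * p ≤ m := by omega
  have hpn : (p : ℝ) ≤ n := by exact_mod_cast hp
  have hn0 : (0 : ℝ) ≤ n := by positivity
  let a : Fin dIn := ⟨0, by omega⟩
  let b : Fin dIn := ⟨1, by omega⟩
  have hab : a ≠ b := by simp [a, b]
  refine le_trans ?_ (one_sub_gadgetProb_le (p := p) (by omega)
    (E := {g : GadgetOutcome m p dIn 1 | g.Expands (1 / 1203)})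
    (F := {g | g.HasSmallTrap a b (4812 * n)} ∪ {g | g.HasLargeTrap a b n}) ?_)
  · have hS := gadgetProb_hasSmallTrap_le (m := m) (p := p) (by omega) hab (t := 4812 * n) hρ0 hρ1
      (by rw [div_le_iff₀ hm0]; linarith) (by omega)
      (by
        have hcast : ((m - p : ℕ) : ℝ) = m - p := Nat.cast_sub (by omega)
        have hpm' : 100 * (p : ℝ) ≤ m := by exact_mod_cast hpm
        rw [hcast, div_le_iff₀ (by linarith)]
        push_cast
        have h : ρ * (m - p) ≥ ρ * (m / 2) :=
          mul_le_mul_of_nonneg_left (by linarith) hρ0.le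
        linarith)
    have hL := gadgetProb_hasLargeTrap_le hpm hab hn1
    have hexp : (1 + 16 * ρ ^ (17 / 12 : ℝ)) ^ (2 * m) ≤
        Real.exp (32 * 9624 ^ (17 / 12 : ℝ) * (m : ℝ) ^ (-(1 / 16) : ℝ)) := by
      have h1 : ρ ^ (17 / 12 : ℝ) = 9624 ^ (17 / 12 : ℝ) * (m : ℝ) ^ (-(17 / 16) : ℝ) := by
        rw [hρ, Real.mul_rpow (by norm_num) (by positivity), ← Real.rpow_mul hm0.le]
        norm_num
      have h2 : (m : ℝ) * (m : ℝ) ^ (-(17 / 16) : ℝ) = (m : ℝ) ^ (-(1 / 16) : ℝ) := by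
        nth_rewrite 1 [← Real.rpow_one (m : ℝ)]
        rw [← Real.rpow_add hm0]
        norm_num
      calc (1 + 16 * ρ ^ (17 / 12 : ℝ)) ^ (2 * m)
          ≤ Real.exp (16 * ρ ^ (17 / 12 : ℝ)) ^ (2 * m) := by
            refine pow_le_pow_left₀ (by positivity) ?_ _
            rw [add_comm]
            exact Real.add_one_le_exp _
        _ = Real.exp (32 * 9624 ^ (17 / 12 : ℝ) * (m : ℝ) ^ (-(1 / 16) : ℝ)) := by
            rw [← Real.exp_nat_mul, h1, ← h2]
            congr 1
            push_cast
            ring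
    have hU := gadgetProb_union_le {g : GadgetOutcome m p dIn 1 | g.HasSmallTrap a b (4812 * n)}
      {g | g.HasLargeTrap a b n}
    unfold trapBound
    rw [← hn]
    linarith
  · intro g hg
    by_contra h
    exact hg (g.hasTrap_of_not_expands a b hp h)

end Asymptotics

theorem theorem4p1 (α : ℝ) (hα0 : 0 < α) (hα : α ≤ 1 / 4) (D : ℕ) :
    ∃ δ : ℝ, 0 < δ ∧ ∃ ε : ℕ → ℝ, Tendsto ε atTop (𝓝 0) ∧
      ∀ m d : ℕ, 1 ≤ m → 3 ≤ d → d ≤ D → ∀ β : ℝ, β < 0 →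
        1 - ε m ≤ gadgetProb m ⌊(m : ℝ) ^ α⌋₊ (d - 1) 1
          {g | ∀ (W : Type u) [Fintype W] (G' : SimpleGraph (GadgetVertex m ⊕ W)),
            g.IsExtension G' → ∀ τ : W → Bool,
              1 - 2 * (m : ℝ) / Real.exp (δ * |β| * d) ≤
                isingCondProb G' β (phaseEvent m W) (boundaryEvent m τ)} := by
  obtain ⟨N, hN⟩ := eventually_atTop.1 eventually_one_sub_trapBound_le
  -- `δ d ≤ 1 / 1203` as `d ≤ D`; below `N` the bound is made trivial
  refine ⟨1 / 1203 / (D + 1), by positivity, fun m => if N ≤ m then trapBound m else 1, ?_, ?_⟩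
  · refine tendsto_trapBound.congr' ?_
    filter_upwards [eventually_ge_atTop N] with m hm
    rw [if_pos hm]
  · intro m d hm hd hdD β hβ
    dsimp only
    split_ifs with hNm
    · refine (hN m hNm _ (d - 1) (floor_rpow_le_floor_rpow hα hm) (by omega)).trans
        (gadgetProb_mono fun g hg W _ G' hG τ => hg.le_isingCondProb hm hG τ hβ ?_)
      have h1 : (d : ℝ) ≤ D + 1 := by exact_mod_cast hdD.trans (Nat.le_succ D)
      have h2 : 1 / 1203 / ((D : ℝ) + 1) * d ≤ 1 / 1203 := by
        rw [div_mul_eq_mul_div, div_le_iff₀ (by positivity)]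
        linarith
      calc 1 / 1203 / ((D : ℝ) + 1) * |β| * d = |β| * (1 / 1203 / ((D : ℝ) + 1) * d) := by ring
        _ ≤ |β| * (1 / 1203) := by gcongr
    · rw [sub_self]
      exact gadgetProb_nonneg _
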